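/- **Conventions.** A 2-category is strict. Composites are written in diagrammatic order. Let $\mathcal C$ be a 2-category and $|\mathcal C|$ its underlying 1-category. A morphism $f:X\to Y$ is an isofibration (resp. a discrete opfibration, DOF) if $f_*:\mathcal C(A,X)\to\mathcal C(A,Y)$ is one for every $A$. An object $X$ is groupoidal if every category $\mathcal C(A,X)$ is a groupoid. $\mathcal C$ *has pita limits* if it has a strict terminal object, strict arrow objects $X^{\to}$ (with universal 2-cell $\partial:\partial_0\to\partial_1$) and strict pullbacks of isofibrations. A morphism $f:A\to X$ is an arrow-wise isomorphism if $\alpha f$ is invertible for every 2-cell $\alpha$ into $A$. A *strict core* of $X$ is an arrow-wise isomorphism $i:X^{\cong}\to X$ such that each $i_*:\mathcal C(A,X^{\cong})\to\mathcal C(A,X)$ is injective on objects and morphisms, with image the category of arrow-wise isomorphisms $A\to X$ and invertible 2-cells between them. **Congruences.** A *gbo-congruence* in $\mathcal C$ is an internal category $C$ in $|\mathcal C|$, with structure morphisms $\pi_{01},\pi_{02},\pi_{12}:C_2\to C_1$, $\pi_0,\pi_1:C_1\to C_0$, $e:C_0\to C_1$, such that $C_0,C_1,C_2$ are groupoidal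 and $\langle\pi_0,\pi_1\rangle:C_1\to C_0\times C_0$ is a DOF. It has a unique reflection morphism $r:C_0^{\to}\to C_1$, i.e. a morphism admitting a 2-cell $\rho:r\to\partial_1e$ with $\rho\langle\pi_0,\pi_1\rangle=\langle\partial,\mathrm{id}_{\partial_1}\rangle$. Let $\tau:C_0^{\to}\to C_0^{\to}$ be the morphism with $\tau\partial=\partial^{-1}$, and $C_3$ the object of composable triples. The gbo-congruence $C$ is *complete* if the square with sides $\langle r,\tau r,r\rangle:C_0^{\to}\to C_3$, $\langle\partial_0,\partial_1\rangle:C_0^{\to}\to C_0\times C_0$, $\langle\pi_{02},\pi_{13}\rangle:C_3\to C_1\times C_1$ and $e\times e:C_0\times C_0\to C_1\times C_1$ is a strict pullback. $\mathrm{Cong}(\mathcal C)$ is the full sub-2-category, on the complete gbo-congruences, of the 2-category of internal categories, internal functors and internal natural transformations in $|\mathcal C|$. **Nerves.** For $[k]=\{0<\dots<k\}$ let $X^{[k]}$ be the strict cotensor ($X^{[0]}=X$, $X^{[1]}=X^{\to}$). A *nerve* of $X$, depending on a choice of $X^{\to}$, $X^{[2]}$ and of the cores below, is the internal category $\mathrm{Nv}(X)$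 in $|\mathcal C|$ given by $(X^{[2]})^{\cong}$, $(X^{\to})^{\cong}$, $X^{\cong}$ with the induced structure morphisms. The *tautological cocone* under it consists of $i:X^{\cong}\to X$ and the 2-cell $i\partial:\pi_0i\to\pi_1i$. A *cocone* under $C$ with vertex $Y$ consists of $\gamma:C_0\to Y$ and $\gamma_{01}:\pi_0\gamma\to\pi_1\gamma$ with $e\gamma_{01}=\mathrm{id}_\gamma$ and $\pi_{02}\gamma_{01}=(\pi_{01}\gamma_{01})(\pi_{12}\gamma_{01})$; a morphism of cocones is a 2-cell $\alpha:\gamma\to\gamma'$ with $(\pi_0\alpha)\gamma'_{01}=\gamma_{01}(\pi_1\alpha)$. A cocone with vertex $X$ is a *strict quotient* of $C$ if for every $Y$ composition with it is an isomorphism from $\mathcal C(X,Y)$ to the category of cocones with vertex $Y$. $\mathcal C$ is *groupoidant* if it has pita limits and strict cores, every complete gbo-congruence in $\mathcal C$ is a nerve (axiom N), and the tautological cocone under every nerve is a strict quotient (axiom Q). **Theorem.** Let $\mathcal C$ be a groupoidant 2-category. Then every object of $\mathcal C$ has a nerve, every nerve is a complete gbo-congruence, and the nerve construction $\mathrm{Nv}:\mathcal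 C\to\mathrm{Cong}(\mathcal C)$ is a strict equivalence of 2-categories. Here $\mathrm{Nv}(f)$ is given by $f^{\cong}$ and $(f^{\to})^{\cong}$, and for $\alpha:f\to g:X\to Y$, $\mathrm{Nv}(\alpha):X^{\cong}\to(Y^{\to})^{\cong}$ is the unique morphism with $\mathrm{Nv}(\alpha)\,i\,\partial=i\,\alpha$. Explicitly: for all $X,Y$ and all nerves $N$ of $X$ and $N'$ of $Y$, the functor $\mathcal C(X,Y)\to\mathrm{Cat}(|\mathcal C|)(N,N')$ is an isomorphism of categories; and for every choice of a nerve of each object, the resulting 2-functor $\mathrm{Nv}:\mathcal C\to\mathrm{Cong}(\mathcal C)$ induces isomorphisms of hom categories, and every object of $\mathrm{Cong}(\mathcal C)$ is equivalent to some $\mathrm{Nv}(X)$. -/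

import Mathlib

open CategoryTheory Bicategory

universe w v u

namespace TwoCat

/-! ### Functors between ordinary categories -/

section Functors

variable {A : Type*} {B : Type*} [Category A] [Category B]

/-- An isomorphism of categories: a functor which is bijective on objects and on morphisms. -/
structure IsIsoOfCats (F : A ⥤ B) : Prop where
  bijective_obj : Function.Bijective F.obj
  bijective_map : ∀ x y : A, Function.Bijective (fun p : x ⟶ y => F.map p)

/-- Isofibrations. Equality in `Arrow B` is equality of morphisms of `B` together with their
domains and codomains. -/
def IsIsofibrationFunctor (F : A ⥤ B) : Prop :=
  ∀ (x : A) (b : B) (f : F.obj x ⟶ b), IsIso f →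
    ∃ (y : A) (p : x ⟶ y), IsIso p ∧ Arrow.mk (F.map p) = Arrow.mk f

/-- Discrete opfibrations: every `f : F x ⟶ b` has a unique lift with domain `x`. -/
def IsDOFFunctor (F : A ⥤ B) : Prop :=
  ∀ (x : A) (b : B) (f : F.obj x ⟶ b),
    ∃! p : (Σ y : A, (x ⟶ y)), Arrow.mk (F.map p.2) = Arrow.mk f

end Functors

/-! ### Strict limits in a 2-category

A 2-category is a bicategory `C` with `[Bicategory.Strict C]`. For a 2-cell `α`, the expressions
`u ◁ α` and `α ▷ f` denote its whiskerings. An equation between 2-cells whose domains and codomains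
agree only up to the associativity and unit laws is written as an equation in
`Arrow (A ⟶ X)`, the set of all 2-cells between morphisms `A ⟶ X`.
In each universal property, the field `..._map` says that the comparison functor is bijective on
objects, and the field `..._cell` says that it is bijective on morphisms. -/

section Limits

variable {C : Type u} [Bicategory.{w, v} C]

/-- Isofibrations in a 2-category, defined representably. -/
def IsIsofibration {X Y : C} (f : X ⟶ Y) : Prop :=
  ∀ A : C, IsIsofibrationFunctor (postcomp A f)

/-- Discrete opfibrations (DOFs) in a 2-category, defined representably. -/
def IsDOF {X Y : C} (f : X ⟶ Y) : Prop :=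
  ∀ A : C, IsDOFFunctor (postcomp A f)

/-- `X` is groupoidal if every hom category into it is a groupoid. -/
def IsGroupoidal (X : C) : Prop :=
  ∀ ⦃A : C⦄ ⦃f g : A ⟶ X⦄ (α : f ⟶ g), IsIso α

/-- Strict terminal objects: each hom category into `T` has exactly one object and exactly one
morphism. -/
def IsStrictTerminal (T : C) : Prop :=
  ∀ A : C, Nonempty (Unique (A ⟶ T)) ∧ ∀ f g : A ⟶ T, Nonempty (Unique (f ⟶ g))

/-- Strict pullback squares. -/
structure IsStrictPullback {P X Y Z : C} (h : P ⟶ X) (k : P ⟶ Y) (f : X ⟶ Z) (g : Y ⟶ Z) :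
    Prop where
  w : h ≫ f = k ≫ g
  existsUnique_map : ∀ {B : C} (h' : B ⟶ X) (k' : B ⟶ Y), h' ≫ f = k' ≫ g →
    ∃! u : B ⟶ P, u ≫ h = h' ∧ u ≫ k = k'
  existsUnique_cell : ∀ {B : C} (u u' : B ⟶ P) (α : u ≫ h ⟶ u' ≫ h) (β : u ≫ k ⟶ u' ≫ k),
    Arrow.mk (α ▷ f) = Arrow.mk (β ▷ g) → ∃! θ : u ⟶ u', θ ▷ h = α ∧ θ ▷ k = β

/-- A strict product of `X` and `Y`. -/
structure StrictProd (X Y : C) where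
  obj : C
  fst : obj ⟶ X
  snd : obj ⟶ Y
  existsUnique_map : ∀ {B : C} (f : B ⟶ X) (g : B ⟶ Y),
    ∃! u : B ⟶ obj, u ≫ fst = f ∧ u ≫ snd = g
  existsUnique_cell : ∀ {B : C} (u u' : B ⟶ obj) (α : u ≫ fst ⟶ u' ≫ fst)
    (β : u ≫ snd ⟶ u' ≫ snd), ∃! θ : u ⟶ u', θ ▷ fst = α ∧ θ ▷ snd = β

/-- The morphism into a product with the given components. -/
noncomputable def StrictProd.pair {X Y : C} (P : StrictProd X Y) {B : C} (f : B ⟶ X)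
    (g : B ⟶ Y) : B ⟶ P.obj :=
  (P.existsUnique_map f g).choose

/-- A strict arrow object of `X`, i.e. a strict cotensor of `X` with the ordered set `{0 < 1}`:
it carries a universal 2-cell `cell : d₀ ⟶ d₁`. -/
structure ArrowObj (X : C) where
  obj : C
  d₀ : obj ⟶ X
  d₁ : obj ⟶ X
  cell : d₀ ⟶ d₁
  existsUnique_map : ∀ {A : C} {f g : A ⟶ X} (α : f ⟶ g),
    ∃! u : A ⟶ obj, Arrow.mk (u ◁ cell) = Arrow.mk α
  existsUnique_cell : ∀ {A : C} (u u' : A ⟶ obj) (a₀ : u ≫ d₀ ⟶ u' ≫ d₀)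
    (a₁ : u ≫ d₁ ⟶ u' ≫ d₁), (u ◁ cell) ≫ a₁ = a₀ ≫ (u' ◁ cell) →
      ∃! θ : u ⟶ u', θ ▷ d₀ = a₀ ∧ θ ▷ d₁ = a₁

/-- A strict cotensor of `X` with the ordered set `{0 < 1 < 2}`: it carries a universal composable
pair of 2-cells (a functor from `{0 < 1 < 2}` to a category is a composable pair of morphisms). -/
structure TriangleObj (X : C) where
  obj : C
  d₀ : obj ⟶ X
  d₁ : obj ⟶ X
  d₂ : obj ⟶ X
  cell₀₁ : d₀ ⟶ d₁
  cell₁₂ : d₁ ⟶ d₂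
  existsUnique_map : ∀ {A : C} {f g h : A ⟶ X} (α : f ⟶ g) (β : g ⟶ h),
    ∃! u : A ⟶ obj, Arrow.mk (u ◁ cell₀₁) = Arrow.mk α ∧ Arrow.mk (u ◁ cell₁₂) = Arrow.mk β
  existsUnique_cell : ∀ {A : C} (u u' : A ⟶ obj) (a₀ : u ≫ d₀ ⟶ u' ≫ d₀)
    (a₁ : u ≫ d₁ ⟶ u' ≫ d₁) (a₂ : u ≫ d₂ ⟶ u' ≫ d₂),
    (u ◁ cell₀₁) ≫ a₁ = a₀ ≫ (u' ◁ cell₀₁) → (u ◁ cell₁₂) ≫ a₂ = a₁ ≫ (u' ◁ cell₁₂) →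
      ∃! θ : u ⟶ u', θ ▷ d₀ = a₀ ∧ θ ▷ d₁ = a₁ ∧ θ ▷ d₂ = a₂

/-- The morphism into an arrow object classifying a 2-cell. -/
noncomputable def ArrowObj.lift {X : C} (a : ArrowObj X) {A : C} {f g : A ⟶ X} (α : f ⟶ g) :
    A ⟶ a.obj :=
  (a.existsUnique_map α).choose

/-- The morphism `f^→ : X^→ ⟶ Y^→` induced by `f : X ⟶ Y`. -/
noncomputable def ArrowObj.map {X Y : C} (a : ArrowObj X) (b : ArrowObj Y) (f : X ⟶ Y) :
    a.obj ⟶ b.obj :=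
  b.lift (a.cell ▷ f)

/-- `f : A ⟶ X` is an arrow-wise isomorphism if it inverts every 2-cell into `A`. -/
def IsArrowwiseIso {A X : C} (f : A ⟶ X) : Prop :=
  ∀ ⦃A' : C⦄ ⦃x y : A' ⟶ A⦄ (α : x ⟶ y), IsIso (α ▷ f)

/-- A strict core of `X`: an arrow-wise isomorphism `ι : obj ⟶ X` such that for each `A`,
composition with `ι` is an injective functor with image the category of arrow-wise isomorphisms
`A ⟶ X` and invertible 2-cells between these. -/
structure StrictCore (X : C) where
  obj : C
  ι : obj ⟶ X
  isArrowwiseIso : IsArrowwiseIso ι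
  existsUnique_map : ∀ {A : C} (f : A ⟶ X), IsArrowwiseIso f → ∃! x : A ⟶ obj, x ≫ ι = f
  existsUnique_cell : ∀ {A : C} (x y : A ⟶ obj) (θ : x ≫ ι ⟶ y ≫ ι), IsIso θ →
    ∃! φ : x ⟶ y, φ ▷ ι = θ

theorem IsArrowwiseIso.comp {A X Y : C} {f : A ⟶ X} (hf : IsArrowwiseIso f) (g : X ⟶ Y) :
    IsArrowwiseIso (f ≫ g) := by
  intro A' x y α
  have := hf α
  rw [whiskerRight_comp]
  infer_instance

theorem IsArrowwiseIso.precomp {A' A X : C} {f : A ⟶ X} (hf : IsArrowwiseIso f) (g : A' ⟶ A) :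
    IsArrowwiseIso (g ≫ f) := by
  intro A'' x y α
  have := hf (α ▷ g)
  rw [whiskerRight_comp]
  infer_instance

/-- The factorization of an arrow-wise isomorphism through the core. -/
noncomputable def StrictCore.lift {X : C} (c : StrictCore X) {A : C} (f : A ⟶ X)
    (hf : IsArrowwiseIso f) : A ⟶ c.obj :=
  (c.existsUnique_map f hf).choose

/-- The morphism `f^≅ : X^≅ ⟶ Y^≅` between cores induced by `f : X ⟶ Y`. -/
noncomputable def StrictCore.map {X Y : C} (c : StrictCore X) (d : StrictCore Y) (f : X ⟶ Y) :
    c.obj ⟶ d.obj :=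
  d.lift (c.ι ≫ f) (c.isArrowwiseIso.comp f)

variable (C) in
/-- `C` has pita limits: a strict terminal object, strict arrow objects, and strict pullbacks of
isofibrations. -/
structure IsPita : Prop where
  terminal : ∃ T : C, IsStrictTerminal T
  arrow : ∀ X : C, Nonempty (ArrowObj X)
  pullback : ∀ {X Y Z : C} (f : X ⟶ Z) (g : Y ⟶ Z), IsIsofibration f →
    ∃ (P : C) (h : P ⟶ X) (k : P ⟶ Y), IsStrictPullback h k f g

end Limits

/-! ### The 2-category of internal categories in a 1-category -/

section Internal

variable {K : Type u} [Category.{v} K]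

variable (K) in
/-- The data of an internal category, with `C₂` the object of composable pairs and
`π₀₂` the composition. -/
structure InternalCatStruct where
  C₀ : K
  C₁ : K
  C₂ : K
  π₀ : C₁ ⟶ C₀
  π₁ : C₁ ⟶ C₀
  e : C₀ ⟶ C₁
  π₀₁ : C₂ ⟶ C₁
  π₁₂ : C₂ ⟶ C₁
  π₀₂ : C₂ ⟶ C₁
  isPullback : IsPullback π₀₁ π₁₂ π₁ π₀
  e_π₀ : e ≫ π₀ = 𝟙 C₀
  e_π₁ : e ≫ π₁ = 𝟙 C₀
  π₀₂_π₀ : π₀₂ ≫ π₀ = π₀₁ ≫ π₀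
  π₀₂_π₁ : π₀₂ ≫ π₁ = π₁₂ ≫ π₁

attribute [simp] InternalCatStruct.e_π₀ InternalCatStruct.e_π₁

theorem InternalCatStruct.e_mul_cond (I : InternalCatStruct K) {A : K} (f : A ⟶ I.C₁) :
    (f ≫ I.π₀ ≫ I.e) ≫ I.π₁ = f ≫ I.π₀ := by simp

theorem InternalCatStruct.mul_e_cond (I : InternalCatStruct K) {A : K} (f : A ⟶ I.C₁) :
    f ≫ I.π₁ = (f ≫ I.π₁ ≫ I.e) ≫ I.π₀ := by simp

/-- The composite of two composable generalized elements of `C₁`. -/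
noncomputable def InternalCatStruct.mul (I : InternalCatStruct K) {A : K} (f g : A ⟶ I.C₁)
    (h : f ≫ I.π₁ = g ≫ I.π₀) : A ⟶ I.C₁ :=
  I.isPullback.lift f g h ≫ I.π₀₂

theorem InternalCatStruct.mul_π₀ (I : InternalCatStruct K) {A : K} (f g : A ⟶ I.C₁)
    (h : f ≫ I.π₁ = g ≫ I.π₀) : I.mul f g h ≫ I.π₀ = f ≫ I.π₀ := by
  simp [InternalCatStruct.mul, I.π₀₂_π₀]

theorem InternalCatStruct.mul_π₁ (I : InternalCatStruct K) {A : K} (f g : A ⟶ I.C₁)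
    (h : f ≫ I.π₁ = g ≫ I.π₀) : I.mul f g h ≫ I.π₁ = g ≫ I.π₁ := by
  simp [InternalCatStruct.mul, I.π₀₂_π₁]

variable (K) in
/-- Internal categories. The unit and associativity laws are stated for generalized elements,
i.e. they say that `K(A, C₁)` is the set of arrows of a category with set of objects `K(A, C₀)`.
If the object of composable triples exists, this is associativity on that object. -/
structure InternalCat extends InternalCatStruct K where
  e_mul : ∀ {A : K} (f : A ⟶ C₁),
    toInternalCatStruct.mul (f ≫ π₀ ≫ e) f (toInternalCatStruct.e_mul_cond f) = f
  mul_e : ∀ {A : K} (f : A ⟶ C₁),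
    toInternalCatStruct.mul f (f ≫ π₁ ≫ e) (toInternalCatStruct.mul_e_cond f) = f
  mul_assoc : ∀ {A : K} (f g h : A ⟶ C₁) (hfg : f ≫ π₁ = g ≫ π₀) (hgh : g ≫ π₁ = h ≫ π₀),
    toInternalCatStruct.mul (toInternalCatStruct.mul f g hfg) h
        ((toInternalCatStruct.mul_π₁ f g hfg).trans hgh) =
      toInternalCatStruct.mul f (toInternalCatStruct.mul g h hgh)
        (hfg.trans (toInternalCatStruct.mul_π₀ g h hgh).symm)

namespace InternalCat

attribute [simp] InternalCatStruct.mul_π₀ InternalCatStruct.mul_π₁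

theorem comp_mul (I : InternalCat K) {A B : K} (w : B ⟶ A) (f g : A ⟶ I.C₁)
    (h : f ≫ I.π₁ = g ≫ I.π₀) :
    w ≫ I.mul f g h = I.mul (w ≫ f) (w ≫ g) (by simp [h]) := by
  unfold InternalCatStruct.mul
  rw [← Category.assoc]
  congr 1
  apply I.isPullback.hom_ext <;> simp

theorem mul_congr (I : InternalCat K) {A : K} {f g f' g' : A ⟶ I.C₁} (h : f ≫ I.π₁ = g ≫ I.π₀)
    (hf : f = f') (hg : g = g') :
    I.mul f g h = I.mul f' g' (by rw [← hf, ← hg, h]) := by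
  subst hf hg; rfl

theorem e_mul' (I : InternalCat K) {A : K} (x : A ⟶ I.C₀) (f : A ⟶ I.C₁) (h : f ≫ I.π₀ = x) :
    I.mul (x ≫ I.e) f (by simp [h]) = f := by
  subst h
  simpa using I.e_mul f

theorem mul_e' (I : InternalCat K) {A : K} (x : A ⟶ I.C₀) (f : A ⟶ I.C₁) (h : f ≫ I.π₁ = x) :
    I.mul f (x ≫ I.e) (by simp [h]) = f := by
  subst h
  simpa using I.mul_e f

/-- Internal functors. -/
@[ext]
structure Hom (I J : InternalCat K) where
  f₀ : I.C₀ ⟶ J.C₀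
  f₁ : I.C₁ ⟶ J.C₁
  f₁_π₀ : f₁ ≫ J.π₀ = I.π₀ ≫ f₀
  f₁_π₁ : f₁ ≫ J.π₁ = I.π₁ ≫ f₀
  e_f₁ : I.e ≫ f₁ = f₀ ≫ J.e
  π₀₂_f₁ : I.π₀₂ ≫ f₁ = J.mul (I.π₀₁ ≫ f₁) (I.π₁₂ ≫ f₁)
    (by
      rw [Category.assoc, Category.assoc, f₁_π₁, f₁_π₀, ← Category.assoc, ← Category.assoc,
        I.isPullback.w])

attribute [simp] Hom.f₁_π₀ Hom.f₁_π₁ Hom.e_f₁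

theorem Hom.mul_f₁ {I J : InternalCat K} (F : Hom I J) {A : K} (f g : A ⟶ I.C₁)
    (h : f ≫ I.π₁ = g ≫ I.π₀) :
    I.mul f g h ≫ F.f₁ = J.mul (f ≫ F.f₁) (g ≫ F.f₁)
      (by simp only [Category.assoc, F.f₁_π₀, F.f₁_π₁]; rw [← Category.assoc, h, Category.assoc]) := by
  have : I.mul f g h ≫ F.f₁ = I.isPullback.lift f g h ≫ (I.π₀₂ ≫ F.f₁) := by
    simp [InternalCatStruct.mul]
  rw [this, F.π₀₂_f₁, comp_mul]
  apply mul_congr <;> simp [← Category.assoc]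

instance : CategoryStruct (InternalCat K) where
  Hom := Hom
  id I :=
    { f₀ := 𝟙 _
      f₁ := 𝟙 _
      f₁_π₀ := by simp
      f₁_π₁ := by simp
      e_f₁ := by simp
      π₀₂_f₁ := by
        rw [Category.comp_id]
        have : I.isPullback.lift I.π₀₁ I.π₁₂ I.isPullback.w = 𝟙 _ := by
          apply I.isPullback.hom_ext <;> simp
        simp [InternalCatStruct.mul, this] }
  comp {I J L} F G :=
    { f₀ := F.f₀ ≫ G.f₀
      f₁ := F.f₁ ≫ G.f₁
      f₁_π₀ := by rw [Category.assoc, G.f₁_π₀, ← Category.assoc, F.f₁_π₀, Category.assoc]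
      f₁_π₁ := by rw [Category.assoc, G.f₁_π₁, ← Category.assoc, F.f₁_π₁, Category.assoc]
      e_f₁ := by rw [← Category.assoc, F.e_f₁, Category.assoc, G.e_f₁, Category.assoc]
      π₀₂_f₁ := by
        rw [← Category.assoc, F.π₀₂_f₁, G.mul_f₁]
        apply mul_congr <;> simp }

@[simp] theorem id_f₀ (I : InternalCat K) : Hom.f₀ (𝟙 I) = 𝟙 _ := rfl
@[simp] theorem id_f₁ (I : InternalCat K) : Hom.f₁ (𝟙 I) = 𝟙 _ := rfl
@[simp] theorem comp_f₀ {I J L : InternalCat K} (F : I ⟶ J) (G : J ⟶ L) :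
    Hom.f₀ (F ≫ G) = F.f₀ ≫ G.f₀ := rfl
@[simp] theorem comp_f₁ {I J L : InternalCat K} (F : I ⟶ J) (G : J ⟶ L) :
    Hom.f₁ (F ≫ G) = F.f₁ ≫ G.f₁ := rfl

theorem hom_ext {I J : InternalCat K} {F G : I ⟶ J} (h₀ : F.f₀ = G.f₀) (h₁ : F.f₁ = G.f₁) :
    F = G := Hom.ext h₀ h₁

/-- Internal natural transformations. -/
@[ext]
structure NatTrans {I J : InternalCat K} (F G : I ⟶ J) where
  app : I.C₀ ⟶ J.C₁
  app_π₀ : app ≫ J.π₀ = F.f₀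
  app_π₁ : app ≫ J.π₁ = G.f₀
  naturality : J.mul F.f₁ (I.π₁ ≫ app) (by simp [app_π₀]) =
    J.mul (I.π₀ ≫ app) G.f₁ (by simp [app_π₁])

attribute [simp] NatTrans.app_π₀ NatTrans.app_π₁

theorem NatTrans.naturality' {I J : InternalCat K} {F G : I ⟶ J} (η : NatTrans F G) {A : K}
    (x : A ⟶ I.C₁) {a b : A ⟶ I.C₀} (ha : x ≫ I.π₀ = a) (hb : x ≫ I.π₁ = b) :
    J.mul (x ≫ F.f₁) (b ≫ η.app) (by simp [← hb]) =
      J.mul (a ≫ η.app) (x ≫ G.f₁) (by simp [← ha]) := by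
  subst ha hb
  have := congrArg (fun t => x ≫ t) η.naturality
  simpa [comp_mul] using this

noncomputable instance homCategory (I J : InternalCat K) : Category (I ⟶ J) where
  Hom := NatTrans
  id F :=
    { app := F.f₀ ≫ J.e
      app_π₀ := by simp
      app_π₁ := by simp
      naturality := by
        have h₀ := J.e_mul' (I.π₀ ≫ F.f₀) F.f₁ (by simp)
        have h₁ := J.mul_e' (I.π₁ ≫ F.f₀) F.f₁ (by simp)
        simp only [Category.assoc] at h₀ h₁
        rw [h₀, h₁] }
  comp {F G H} η θ :=
    { app := J.mul η.app θ.app (by simp)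
      app_π₀ := by simp
      app_π₁ := by simp
      naturality := by
        have h₁ := η.naturality
        have h₂ := θ.naturality
        rw [mul_congr J _ rfl (J.comp_mul I.π₁ η.app θ.app _),
          mul_congr J _ (J.comp_mul I.π₀ η.app θ.app _) rfl,
          ← J.mul_assoc _ _ _ (by simp) (by simp), mul_congr J _ h₁ rfl,
          J.mul_assoc _ _ _ (by simp) (by simp), mul_congr J _ rfl h₂,
          ← J.mul_assoc _ _ _ (by simp) (by simp)] }
  id_comp {F G} η := NatTrans.ext (J.e_mul' _ _ (by simp))
  comp_id {F G} η := NatTrans.ext (J.mul_e' _ _ (by simp))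
  assoc η θ ζ := NatTrans.ext (J.mul_assoc _ _ _ _ _)

theorem nat_ext {I J : InternalCat K} {F G : I ⟶ J} {η θ : F ⟶ G} (h : η.app = θ.app) : η = θ :=
  NatTrans.ext h

@[simp] theorem id_app {I J : InternalCat K} (F : I ⟶ J) :
    NatTrans.app (𝟙 F) = F.f₀ ≫ J.e := rfl
theorem comp_app {I J : InternalCat K} {F G H : I ⟶ J} (η : F ⟶ G) (θ : G ⟶ H) :
    NatTrans.app (η ≫ θ) = J.mul η.app θ.app (by simp) := rfl

theorem eqToHom_app {I J : InternalCat K} {F G : I ⟶ J} (h : F = G) :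
    NatTrans.app (eqToHom h) = F.f₀ ≫ J.e := by
  subst h; rfl

theorem comp_eqToHom_app {I J : InternalCat K} {F G H : I ⟶ J} (η : F ⟶ G) (h : G = H) :
    NatTrans.app (η ≫ eqToHom h) = η.app := by
  subst h; simp

theorem eqToHom_comp_app {I J : InternalCat K} {F G H : I ⟶ J} (h : F = G) (η : G ⟶ H) :
    NatTrans.app (eqToHom h ≫ η) = η.app := by
  subst h; simp

/-- Whiskering of an internal natural transformation with a functor on the left. -/
def whiskerL {I J L : InternalCat K} (F : I ⟶ J) {G H : J ⟶ L} (η : G ⟶ H) :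
    F ≫ G ⟶ F ≫ H :=
  NatTrans.mk (F := F ≫ G) (G := F ≫ H) (F.f₀ ≫ η.app) (by simp) (by simp) (by
    have := η.naturality' F.f₁ F.f₁_π₀ F.f₁_π₁
    simpa using this)

/-- Whiskering of an internal natural transformation with a functor on the right. -/
def whiskerR {I J L : InternalCat K} {F G : I ⟶ J} (η : F ⟶ G) (H : J ⟶ L) :
    F ≫ H ⟶ G ≫ H :=
  NatTrans.mk (F := F ≫ H) (G := G ≫ H) (η.app ≫ H.f₁)
    (by rw [Category.assoc, H.f₁_π₀, ← Category.assoc, η.app_π₀]; rfl)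
    (by rw [Category.assoc, H.f₁_π₁, ← Category.assoc, η.app_π₁]; rfl) (by
    have := congrArg (fun t => t ≫ H.f₁) η.naturality
    simpa [Hom.mul_f₁] using this)

@[simp] theorem whiskerL_app {I J L : InternalCat K} (F : I ⟶ J) {G H : J ⟶ L} (η : G ⟶ H) :
    (whiskerL F η).app = F.f₀ ≫ η.app := rfl
@[simp] theorem whiskerR_app {I J L : InternalCat K} {F G : I ⟶ J} (η : F ⟶ G) (H : J ⟶ L) :
    (whiskerR η H).app = η.app ≫ H.f₁ := rfl

theorem id_comp' {I J : InternalCat K} (F : I ⟶ J) : 𝟙 I ≫ F = F := hom_ext (by simp) (by simp)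
theorem comp_id' {I J : InternalCat K} (F : I ⟶ J) : F ≫ 𝟙 J = F := hom_ext (by simp) (by simp)
theorem assoc' {I J L M : InternalCat K} (F : I ⟶ J) (G : J ⟶ L) (H : L ⟶ M) :
    (F ≫ G) ≫ H = F ≫ G ≫ H := hom_ext (by simp) (by simp)

/-- The 2-category `Cat(K)` of internal categories, internal functors and internal natural
transformations. -/
noncomputable instance bicategory : Bicategory (InternalCat K) where
  whiskerLeft F _ _ η := whiskerL F η
  whiskerRight η H := whiskerR η H
  associator F G H := eqToIso (assoc' F G H)
  leftUnitor F := eqToIso (id_comp' F)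
  rightUnitor F := eqToIso (comp_id' F)
  whiskerLeft_id _ _ := by
    apply nat_ext
    simp
  whiskerLeft_comp F _ _ _ η θ := by
    apply nat_ext
    simp [comp_app, comp_mul]
  id_whiskerLeft η := by
    apply nat_ext
    simp [eqToHom_comp_app, comp_eqToHom_app]
  comp_whiskerLeft F G _ _ η := by
    apply nat_ext
    simp [eqToHom_comp_app, comp_eqToHom_app]
  id_whiskerRight _ _ := by
    apply nat_ext
    simp
  comp_whiskerRight η θ H := by
    apply nat_ext
    simp [comp_app, Hom.mul_f₁]
  whiskerRight_id η := by
    apply nat_ext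
    simp [eqToHom_comp_app, comp_eqToHom_app]
  whiskerRight_comp η F G := by
    apply nat_ext
    simp [eqToHom_comp_app, comp_eqToHom_app]
  whisker_assoc F _ _ η G := by
    apply nat_ext
    simp [eqToHom_comp_app, comp_eqToHom_app]
  whisker_exchange {I J L F G H M} η θ := by
    apply nat_ext
    simp only [comp_app, whiskerL_app, whiskerR_app]
    exact (θ.naturality' η.app η.app_π₀ η.app_π₁).symm
  pentagon {I J L M N} F G H P := by
    apply nat_ext
    have h := N.e_mul' (F.f₀ ≫ G.f₀ ≫ H.f₀ ≫ P.f₀) ((F.f₀ ≫ G.f₀ ≫ H.f₀ ≫ P.f₀) ≫ N.e) (by simp)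
    simp only [Category.assoc] at h
    simp only [comp_app, eqToHom_app, eqToIso.hom, comp_f₀, whiskerL_app, whiskerR_app,
      Category.assoc, Hom.e_f₁]
    rw [mul_congr N _ rfl h, h]
  triangle {I J L} F G := by
    apply nat_ext
    have h := L.e_mul' (F.f₀ ≫ G.f₀) ((F.f₀ ≫ G.f₀) ≫ L.e) (by simp)
    simpa [comp_app, eqToHom_app] using h

instance strict : Bicategory.Strict (InternalCat K) where
  id_comp := id_comp'
  comp_id := comp_id'
  assoc := assoc'
  leftUnitor_eqToIso _ := rfl
  rightUnitor_eqToIso _ := rfl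
  associator_eqToIso _ _ _ := rfl

end InternalCat

end Internal

/-! ### 2-cells of a strict 2-category as elements of `Arrow (A ⟶ X)` -/

section Cells

variable {C : Type u} [Bicategory.{w, v} C]

/-- Whiskering on the left. -/
def wL {A' A X : C} (x : A' ⟶ A) (a : Arrow (A ⟶ X)) : Arrow (A' ⟶ X) := Arrow.mk (x ◁ a.hom)

/-- Whiskering on the right. -/
def wR {A X Y : C} (a : Arrow (A ⟶ X)) (f : X ⟶ Y) : Arrow (A ⟶ Y) := Arrow.mk (a.hom ▷ f)

/-- Composition of arrows which are composable up to an equality of objects. -/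
def acomp {D : Type*} [Category D] (a b : Arrow D) (h : a.right = b.left) : Arrow D :=
  Arrow.mk (a.hom ≫ eqToHom h ≫ b.hom)

theorem acomp_mk {D : Type*} [Category D] {x y z : D} (f : x ⟶ y) (g : y ⟶ z) :
    acomp (Arrow.mk f) (Arrow.mk g) rfl = Arrow.mk (f ≫ g) := by
  simp [acomp]

theorem acomp_congr {D : Type*} [Category D] {a b a' b' : Arrow D} (h : a.right = b.left)
    (ha : a = a') (hb : b = b') : acomp a b h = acomp a' b' (by rw [← ha, ← hb, h]) := by
  subst ha hb; rfl

theorem acomp_assoc {D : Type*} [Category D] (a b c : Arrow D) (h : a.right = b.left)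
    (k : b.right = c.left) : acomp (acomp a b h) c k = acomp a (acomp b c k) h := by
  simp [acomp]

theorem id_acomp {D : Type*} [Category D] (x : D) (a : Arrow D) (h : x = a.left) :
    acomp (Arrow.mk (𝟙 x)) a h = a := by
  subst h; simp [acomp]

theorem acomp_id {D : Type*} [Category D] (x : D) (a : Arrow D) (h : a.right = x) :
    acomp a (Arrow.mk (𝟙 x)) h = a := by
  subst h; simp [acomp]

theorem mk_comp_congr {D : Type*} [Category D] {x y z x' y' z' : D} {f : x ⟶ y} {g : y ⟶ z}
    {f' : x' ⟶ y'} {g' : y' ⟶ z'} (hf : Arrow.mk f = Arrow.mk f')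
    (hg : Arrow.mk g = Arrow.mk g') : Arrow.mk (f ≫ g) = Arrow.mk (f' ≫ g') := by
  rw [← acomp_mk, ← acomp_mk, acomp_congr _ hf hg]

theorem mk_wL {A' A X : C} (x : A' ⟶ A) {f g : A ⟶ X} (α : f ⟶ g) :
    Arrow.mk (x ◁ α) = wL x (Arrow.mk α) := rfl

theorem mk_wR {A X Y : C} {f g : A ⟶ X} (α : f ⟶ g) (k : X ⟶ Y) :
    Arrow.mk (α ▷ k) = wR (Arrow.mk α) k := rfl

@[simp] theorem wL_left {A' A X : C} (x : A' ⟶ A) (a : Arrow (A ⟶ X)) :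
    (wL x a).left = x ≫ a.left := rfl
@[simp] theorem wL_right {A' A X : C} (x : A' ⟶ A) (a : Arrow (A ⟶ X)) :
    (wL x a).right = x ≫ a.right := rfl
@[simp] theorem wR_left {A X Y : C} (a : Arrow (A ⟶ X)) (f : X ⟶ Y) :
    (wR a f).left = a.left ≫ f := rfl
@[simp] theorem wR_right {A X Y : C} (a : Arrow (A ⟶ X)) (f : X ⟶ Y) :
    (wR a f).right = a.right ≫ f := rfl
@[simp] theorem acomp_left {D : Type*} [Category D] (a b : Arrow D) (h : a.right = b.left) :
    (acomp a b h).left = a.left := rfl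
@[simp] theorem acomp_right {D : Type*} [Category D] (a b : Arrow D) (h : a.right = b.left) :
    (acomp a b h).right = b.right := rfl

theorem wL_mk_id {A' A X : C} (x : A' ⟶ A) (f : A ⟶ X) :
    wL x (Arrow.mk (𝟙 f)) = Arrow.mk (𝟙 (x ≫ f)) := by simp [wL]

theorem wR_mk_id {A X Y : C} (f : A ⟶ X) (g : X ⟶ Y) :
    wR (Arrow.mk (𝟙 f)) g = Arrow.mk (𝟙 (f ≫ g)) := by simp [wR]

theorem wL_acomp {A' A X : C} (x : A' ⟶ A) (a b : Arrow (A ⟶ X)) (h : a.right = b.left) :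
    wL x (acomp a b h) = acomp (wL x a) (wL x b) (by simp [h]) := by
  simp [wL, acomp]

theorem wR_acomp {A X Y : C} (a b : Arrow (A ⟶ X)) (h : a.right = b.left) (f : X ⟶ Y) :
    wR (acomp a b h) f = acomp (wR a f) (wR b f) (by simp [h]) := by
  simp [wR, acomp]

variable [Bicategory.Strict C]

theorem wL_comp {A'' A' A X : C} (y : A'' ⟶ A') (x : A' ⟶ A) (a : Arrow (A ⟶ X)) :
    wL (y ≫ x) a = wL y (wL x a) := by
  simp [wL, Strict.associator_eqToIso, Arrow.arrow_mk_eqToHom_comp, ← Category.assoc,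
    Arrow.arrow_mk_comp_eqToHom]

theorem wR_comp {A X Y Z : C} (a : Arrow (A ⟶ X)) (f : X ⟶ Y) (g : Y ⟶ Z) :
    wR a (f ≫ g) = wR (wR a f) g := by
  simp [wR, Strict.associator_eqToIso, Arrow.arrow_mk_eqToHom_comp, ← Category.assoc,
    Arrow.arrow_mk_comp_eqToHom]

theorem wL_wR {A' A X Y : C} (x : A' ⟶ A) (a : Arrow (A ⟶ X)) (f : X ⟶ Y) :
    wL x (wR a f) = wR (wL x a) f := by
  simp [wL, wR, Strict.associator_eqToIso, Arrow.arrow_mk_eqToHom_comp, ← Category.assoc,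
    Arrow.arrow_mk_comp_eqToHom]

theorem wL_id {A X : C} (a : Arrow (A ⟶ X)) : wL (𝟙 A) a = a := by
  simp [wL, Strict.leftUnitor_eqToIso, Arrow.arrow_mk_eqToHom_comp, ← Category.assoc,
    Arrow.arrow_mk_comp_eqToHom]

theorem wR_id {A X : C} (a : Arrow (A ⟶ X)) : wR a (𝟙 X) = a := by
  simp [wR, Strict.rightUnitor_eqToIso, Arrow.arrow_mk_eqToHom_comp, ← Category.assoc,
    Arrow.arrow_mk_comp_eqToHom]

theorem exchange {A X Y : C} (a : Arrow (A ⟶ X)) (b : Arrow (X ⟶ Y)) :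
    acomp (wL a.left b) (wR a b.right) rfl = acomp (wR a b.left) (wL a.right b) rfl := by
  simp [acomp, wL, wR, whisker_exchange]

end Cells

/-! ### Congruences -/

section Congruences

variable {C : Type u} [Bicategory.{w, v} C] [Bicategory.Strict C]

/-- An internal double category: an internal category in the underlying 1-category of `C`
such that `⟨π₀, π₁⟩ : C₁ ⟶ C₀ × C₀` is an isofibration. -/
def IsInternalDoubleCat (I : InternalCat C) : Prop :=
  ∃ P : StrictProd I.C₀ I.C₀, IsIsofibration (P.pair I.π₀ I.π₁)

/-- A groupoidal bo-congruence (gbo-congruence). -/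
structure IsGboCongruence (I : InternalCat C) : Prop where
  isInternalDoubleCat : IsInternalDoubleCat I
  groupoidal₀ : IsGroupoidal I.C₀
  groupoidal₁ : IsGroupoidal I.C₁
  groupoidal₂ : IsGroupoidal I.C₂
  isDOF : ∃ P : StrictProd I.C₀ I.C₀, IsDOF (P.pair I.π₀ I.π₁)

/-- `r : C₀^→ ⟶ C₁` is a reflection morphism: there is a 2-cell `ρ : r ⟶ ∂₁ e` whose composite
with `⟨π₀, π₁⟩` is `⟨∂, id⟩`. -/
def IsReflection (I : InternalCat C) (a : ArrowObj I.C₀) (r : a.obj ⟶ I.C₁) : Prop :=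
  ∃ ρ : r ⟶ a.d₁ ≫ I.e,
    Arrow.mk (ρ ▷ I.π₀) = Arrow.mk a.cell ∧ Arrow.mk (ρ ▷ I.π₁) = Arrow.mk (𝟙 a.d₁)

/-- `τ : X^→ ⟶ X^→` is the inversion morphism: it classifies the inverse of the universal
2-cell. -/
def IsInversion {X : C} (a : ArrowObj X) (τ : a.obj ⟶ a.obj) : Prop :=
  ∃ _ : IsIso a.cell, Arrow.mk (τ ◁ a.cell) = Arrow.mk (inv a.cell)

/-- Rezk completeness: the square with sides `⟨r, τ r, r⟩ : C₀^→ ⟶ C₃`,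
`⟨∂₀, ∂₁⟩ : C₀^→ ⟶ C₀ × C₀`, `⟨π₀₂, π₁₃⟩ : C₃ ⟶ C₁ × C₁` and `e × e : C₀ × C₀ ⟶ C₁ × C₁` is a strict
pullback. Here `C₃` is the object of triples, i.e. the pullback of `π₁₂` and `π₀₁`, and `t` is
`⟨r, τ r, r⟩`. All the auxiliary objects and morphisms are unique up to unique isomorphism. -/
def IsRezkComplete (I : InternalCat C) : Prop :=
  ∃ (a : ArrowObj I.C₀) (r : a.obj ⟶ I.C₁) (τ : a.obj ⟶ a.obj)
    (P : StrictProd I.C₀ I.C₀) (Q : StrictProd I.C₁ I.C₁)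
    (C₃ : C) (π₀₁₂ π₁₂₃ : C₃ ⟶ I.C₂) (t : a.obj ⟶ C₃),
    IsReflection I a r ∧ IsInversion a τ ∧ IsStrictPullback π₀₁₂ π₁₂₃ I.π₁₂ I.π₀₁ ∧
    t ≫ π₀₁₂ ≫ I.π₀₁ = r ∧ t ≫ π₀₁₂ ≫ I.π₁₂ = τ ≫ r ∧ t ≫ π₁₂₃ ≫ I.π₁₂ = r ∧
    IsStrictPullback t (P.pair a.d₀ a.d₁)
      (Q.pair (π₀₁₂ ≫ I.π₀₂) (π₁₂₃ ≫ I.π₀₂)) (Q.pair (P.fst ≫ I.e) (P.snd ≫ I.e))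

/-- Complete (gbo-)congruences. -/
structure IsCompleteCongruence (I : InternalCat C) : Prop where
  isGboCongruence : IsGboCongruence I
  isRezkComplete : IsRezkComplete I

variable (C) in
/-- `Cong(C)`: the full sub-2-category of the 2-category of internal categories in the underlying
1-category of `C` on the complete congruences. -/
abbrev Cong : Type _ :=
  InducedBicategory (InternalCat C)
    (Subtype.val : { I : InternalCat C // IsCompleteCongruence I } → InternalCat C)

/-- A cocone under an internal category `I` with vertex `X`. -/
structure Cocone (I : InternalCat C) (X : C) where
  γ : I.C₀ ⟶ X
  γ₀₁ : I.π₀ ≫ γ ⟶ I.π₁ ≫ γ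
  unit : Arrow.mk (I.e ◁ γ₀₁) = Arrow.mk (𝟙 γ)
  mul : Arrow.mk (I.π₀₂ ◁ γ₀₁) = Arrow.mk ((I.π₀₁ ◁ γ₀₁) ≫
    eqToHom (by rw [← Strict.assoc, I.isPullback.w, Strict.assoc]) ≫ (I.π₁₂ ◁ γ₀₁))

/-- The 2-cell of the cocone obtained by composing a cocone with `y : X ⟶ Y`. -/
def Cocone.push {I : InternalCat C} {X Y : C} (c : Cocone I X) (y : X ⟶ Y) :
    I.π₀ ≫ c.γ ≫ y ⟶ I.π₁ ≫ c.γ ≫ y :=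
  (α_ I.π₀ c.γ y).inv ≫ (c.γ₀₁ ▷ y) ≫ (α_ I.π₁ c.γ y).hom

/-- A cocone with vertex `X` is a strict quotient if for each `Y` composition with it is an
isomorphism from the category of morphisms `X ⟶ Y` to the category of cocones with vertex `Y`, in
which a morphism of cocones is a 2-cell `α : γ ⟶ γ'` with `(π₀ α) γ₀₁' = γ₀₁ (π₁ α)`. -/
structure Cocone.IsStrictQuotient {I : InternalCat C} {X : C} (c : Cocone I X) : Prop where
  existsUnique_map : ∀ {Y : C} (d : Cocone I Y),
    ∃! y : X ⟶ Y, c.γ ≫ y = d.γ ∧ Arrow.mk (c.push y) = Arrow.mk d.γ₀₁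
  existsUnique_cell : ∀ {Y : C} (y y' : X ⟶ Y) (α : c.γ ≫ y ⟶ c.γ ≫ y'),
    (I.π₀ ◁ α) ≫ c.push y' = c.push y ≫ (I.π₁ ◁ α) → ∃! θ : y ⟶ y', c.γ ◁ θ = α

end Congruences

/-! ### Nerves -/

section Nerves

variable {C : Type u} [Bicategory.{w, v} C]

/-- The choices that determine a nerve of `X`: an arrow object `X^[1]`, a cotensor `X^[2]`, and
cores of `X`, `X^[1]`, `X^[2]`. -/
structure NerveSpec (X : C) where
  arr : ArrowObj X
  tri : TriangleObj X
  core₀ : StrictCore X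
  core₁ : StrictCore arr.obj
  core₂ : StrictCore tri.obj

theorem ArrowObj.lift_spec {X : C} (a : ArrowObj X) {A : C} {f g : A ⟶ X} (α : f ⟶ g) :
    Arrow.mk (a.lift α ◁ a.cell) = Arrow.mk α :=
  (a.existsUnique_map α).choose_spec.1

theorem ArrowObj.hom_ext {X : C} (a : ArrowObj X) {A : C} {x y : A ⟶ a.obj}
    (h : wL x (Arrow.mk a.cell) = wL y (Arrow.mk a.cell)) : x = y :=
  (a.existsUnique_map (y ◁ a.cell)).unique h rfl

theorem ArrowObj.wL_lift {X : C} (a : ArrowObj X) {A : C} {f g : A ⟶ X} (α : f ⟶ g) :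
    wL (a.lift α) (Arrow.mk a.cell) = Arrow.mk α := a.lift_spec α

@[simp] theorem ArrowObj.lift_d₀ {X : C} (a : ArrowObj X) {A : C} {f g : A ⟶ X} (α : f ⟶ g) :
    a.lift α ≫ a.d₀ = f := congrArg Arrow.left (a.wL_lift α)

@[simp] theorem ArrowObj.lift_d₁ {X : C} (a : ArrowObj X) {A : C} {f g : A ⟶ X} (α : f ⟶ g) :
    a.lift α ≫ a.d₁ = g := congrArg Arrow.right (a.wL_lift α)

@[simp] theorem StrictCore.lift_ι {X : C} (c : StrictCore X) {A : C} (f : A ⟶ X)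
    (hf : IsArrowwiseIso f) : c.lift f hf ≫ c.ι = f :=
  (c.existsUnique_map f hf).choose_spec.1

@[simp] theorem StrictCore.map_ι {X Y : C} (c : StrictCore X) (d : StrictCore Y) (f : X ⟶ Y) :
    c.map d f ≫ d.ι = c.ι ≫ f := d.lift_ι _ _

theorem StrictCore.hom_ext {X : C} (c : StrictCore X) {A : C} {x y : A ⟶ c.obj}
    (h : x ≫ c.ι = y ≫ c.ι) : x = y :=
  (c.existsUnique_map (y ≫ c.ι) (c.isArrowwiseIso.precomp y)).unique h rfl

/-- A morphism into an arrow object is an arrow-wise isomorphism if its two components are. -/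
theorem ArrowObj.isArrowwiseIso {X : C} (a : ArrowObj X) {A : C} {x : A ⟶ a.obj}
    (h₀ : IsArrowwiseIso (x ≫ a.d₀)) (h₁ : IsArrowwiseIso (x ≫ a.d₁)) : IsArrowwiseIso x := by
  intro A' y z α
  have key : ∀ {p q : A' ⟶ a.obj} (θ : p ⟶ q), IsIso (θ ▷ a.d₀) → IsIso (θ ▷ a.d₁) → IsIso θ := by
    intro p q θ i₀ i₁
    have sq : (p ◁ a.cell) ≫ θ ▷ a.d₁ = θ ▷ a.d₀ ≫ (q ◁ a.cell) := whisker_exchange θ a.cell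
    obtain ⟨φ, ⟨hφ₀, hφ₁⟩, -⟩ := a.existsUnique_cell q p (inv (θ ▷ a.d₀)) (inv (θ ▷ a.d₁)) (by
      rw [IsIso.comp_inv_eq, Category.assoc, IsIso.eq_inv_comp, sq])
    refine ⟨φ, ?_, ?_⟩
    · refine (a.existsUnique_cell p p (𝟙 _) (𝟙 _) (by simp)).unique ?_ (by simp)
      simp [hφ₀, hφ₁]
    · refine (a.existsUnique_cell q q (𝟙 _) (𝟙 _) (by simp)).unique ?_ (by simp)
      simp [hφ₀, hφ₁]
  have i₀ := h₀ α
  have i₁ := h₁ α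
  rw [whiskerRight_comp] at i₀ i₁
  refine key (α ▷ x) ?_ ?_
  · simpa using i₀
  · simpa using i₁

/-- A morphism into `X^[2]` is an arrow-wise isomorphism if its three components are. -/
theorem TriangleObj.isArrowwiseIso {X : C} (a : TriangleObj X) {A : C} {x : A ⟶ a.obj}
    (h₀ : IsArrowwiseIso (x ≫ a.d₀)) (h₁ : IsArrowwiseIso (x ≫ a.d₁))
    (h₂ : IsArrowwiseIso (x ≫ a.d₂)) : IsArrowwiseIso x := by
  intro A' y z α
  have key : ∀ {p q : A' ⟶ a.obj} (θ : p ⟶ q), IsIso (θ ▷ a.d₀) → IsIso (θ ▷ a.d₁) →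
      IsIso (θ ▷ a.d₂) → IsIso θ := by
    intro p q θ i₀ i₁ i₂
    have sq := whisker_exchange θ a.cell₀₁
    have sq' := whisker_exchange θ a.cell₁₂
    obtain ⟨φ, ⟨hφ₀, hφ₁, hφ₂⟩, -⟩ := a.existsUnique_cell q p (inv (θ ▷ a.d₀)) (inv (θ ▷ a.d₁))
      (inv (θ ▷ a.d₂)) (by rw [IsIso.comp_inv_eq, Category.assoc, IsIso.eq_inv_comp, sq])
      (by rw [IsIso.comp_inv_eq, Category.assoc, IsIso.eq_inv_comp, sq'])
    refine ⟨φ, ?_, ?_⟩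
    · refine (a.existsUnique_cell p p (𝟙 _) (𝟙 _) (𝟙 _) (by simp) (by simp)).unique ?_ (by simp)
      simp [hφ₀, hφ₁, hφ₂]
    · refine (a.existsUnique_cell q q (𝟙 _) (𝟙 _) (𝟙 _) (by simp) (by simp)).unique ?_ (by simp)
      simp [hφ₀, hφ₁, hφ₂]
  have i₀ := h₀ α
  have i₁ := h₁ α
  have i₂ := h₂ α
  rw [whiskerRight_comp] at i₀ i₁ i₂
  refine key (α ▷ x) ?_ ?_ ?_
  · simpa using i₀
  · simpa using i₁
  · simpa using i₂

namespace NerveSpec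

variable {X Y Z : C} (s : NerveSpec X) (t : NerveSpec Y)

/-- The 2-cell into `X` classified by a morphism into the core of the arrow object. -/
def cell {A : C} (x : A ⟶ s.core₁.obj) : Arrow (A ⟶ X) :=
  Arrow.mk ((x ≫ s.core₁.ι) ◁ s.arr.cell)

theorem cell_ext {A : C} {x y : A ⟶ s.core₁.obj} (h : s.cell x = s.cell y) : x = y :=
  s.core₁.hom_ext (s.arr.hom_ext h)

/-- The morphism into the core of the arrow object classifying a 2-cell between arrow-wise
isomorphisms. -/
noncomputable def lift₁ {A : C} {f g : A ⟶ X} (α : f ⟶ g) (hf : IsArrowwiseIso f)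
    (hg : IsArrowwiseIso g) : A ⟶ s.core₁.obj :=
  s.core₁.lift (s.arr.lift α) (s.arr.isArrowwiseIso (by simpa using hf) (by simpa using hg))

theorem cell_lift₁ {A : C} {f g : A ⟶ X} (α : f ⟶ g) (hf : IsArrowwiseIso f)
    (hg : IsArrowwiseIso g) : s.cell (s.lift₁ α hf hg) = Arrow.mk α := by
  unfold cell lift₁
  rw [StrictCore.lift_ι]
  exact s.arr.lift_spec α

/-- The morphism `X^{δ₀₀} : X ⟶ X^→`. -/
noncomputable def degen : X ⟶ s.arr.obj := s.arr.lift (𝟙 (𝟙 X))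

/-- The morphisms `X^{δ_{ij}} : X^[2] ⟶ X^→`. -/
noncomputable def face₀₁ : s.tri.obj ⟶ s.arr.obj := s.arr.lift s.tri.cell₀₁
/-- See `face₀₁`. -/
noncomputable def face₁₂ : s.tri.obj ⟶ s.arr.obj := s.arr.lift s.tri.cell₁₂
/-- See `face₀₁`. -/
noncomputable def face₀₂ : s.tri.obj ⟶ s.arr.obj := s.arr.lift (s.tri.cell₀₁ ≫ s.tri.cell₁₂)

/-- The source morphism of the nerve. -/
noncomputable def π₀ : s.core₁.obj ⟶ s.core₀.obj := s.core₁.map s.core₀ s.arr.d₀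
/-- The target morphism of the nerve. -/
noncomputable def π₁ : s.core₁.obj ⟶ s.core₀.obj := s.core₁.map s.core₀ s.arr.d₁
/-- The identity morphism of the nerve. -/
noncomputable def e : s.core₀.obj ⟶ s.core₁.obj := s.core₀.map s.core₁ s.degen
/-- The first projection of the nerve. -/
noncomputable def π₀₁ : s.core₂.obj ⟶ s.core₁.obj := s.core₂.map s.core₁ s.face₀₁
/-- The second projection of the nerve. -/
noncomputable def π₁₂ : s.core₂.obj ⟶ s.core₁.obj := s.core₂.map s.core₁ s.face₁₂
/-- The composition morphism of the nerve. -/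
noncomputable def π₀₂ : s.core₂.obj ⟶ s.core₁.obj := s.core₂.map s.core₁ s.face₀₂

theorem π₀_ι : s.π₀ ≫ s.core₀.ι = s.core₁.ι ≫ s.arr.d₀ := s.core₁.map_ι s.core₀ s.arr.d₀

theorem π₁_ι : s.π₁ ≫ s.core₀.ι = s.core₁.ι ≫ s.arr.d₁ := s.core₁.map_ι s.core₀ s.arr.d₁

/-- The 2-cell `(X^→)^≅ ⟶ X` given by `ι ∂`, viewed as a 2-cell `π₀ ι ⟶ π₁ ι`. -/
noncomputable def tautologicalCell : s.π₀ ≫ s.core₀.ι ⟶ s.π₁ ≫ s.core₀.ι :=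
  eqToHom s.π₀_ι ≫ (s.core₁.ι ◁ s.arr.cell) ≫
    eqToHom s.π₁_ι.symm

theorem mk_tautologicalCell :
    Arrow.mk s.tautologicalCell = wL s.core₁.ι (Arrow.mk s.arr.cell) := by
  unfold tautologicalCell
  rw [Arrow.arrow_mk_eqToHom_comp, Arrow.arrow_mk_comp_eqToHom]; rfl

variable [Bicategory.Strict C]

theorem cell_eq {A : C} (x : A ⟶ s.core₁.obj) :
    s.cell x = wL x (wL s.core₁.ι (Arrow.mk s.arr.cell)) := by
  rw [← wL_comp]; rfl

theorem cell_comp {A B : C} (y : B ⟶ A) (x : A ⟶ s.core₁.obj) :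
    s.cell (y ≫ x) = wL y (s.cell x) := by
  simp only [cell_eq, wL_comp]

theorem cell_left {A : C} (x : A ⟶ s.core₁.obj) :
    (s.cell x).left = (x ≫ s.π₀) ≫ s.core₀.ι := by
  change (x ≫ s.core₁.ι) ≫ s.arr.d₀ = _
  rw [Strict.assoc, Strict.assoc, π₀, StrictCore.map_ι]

theorem cell_right {A : C} (x : A ⟶ s.core₁.obj) :
    (s.cell x).right = (x ≫ s.π₁) ≫ s.core₀.ι := by
  change (x ≫ s.core₁.ι) ≫ s.arr.d₁ = _
  rw [Strict.assoc, Strict.assoc, π₁, StrictCore.map_ι]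

theorem cell_e {A : C} (x : A ⟶ s.core₀.obj) :
    s.cell (x ≫ s.e) = Arrow.mk (𝟙 (x ≫ s.core₀.ι)) := by
  change wL ((x ≫ s.e) ≫ s.core₁.ι) (Arrow.mk s.arr.cell) = _
  rw [Strict.assoc, e, StrictCore.map_ι, ← Strict.assoc, wL_comp, degen, ArrowObj.wL_lift,
    wL_mk_id, Strict.comp_id]

theorem cell_e₁ : s.cell s.e = Arrow.mk (𝟙 s.core₀.ι) := by
  have h := s.cell_e (𝟙 _)
  rwa [Strict.id_comp, Strict.id_comp] at h

theorem cell_π₀_e {A : C} (x : A ⟶ s.core₁.obj) :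
    s.cell (x ≫ s.π₀ ≫ s.e) = Arrow.mk (𝟙 ((x ≫ s.π₀) ≫ s.core₀.ι)) := by
  rw [← Strict.assoc, cell_e]

theorem cell_π₁_e {A : C} (x : A ⟶ s.core₁.obj) :
    s.cell (x ≫ s.π₁ ≫ s.e) = Arrow.mk (𝟙 ((x ≫ s.π₁) ≫ s.core₀.ι)) := by
  rw [← Strict.assoc, cell_e]

theorem cell_face {A : C} (x : A ⟶ s.core₂.obj) {f g : s.tri.obj ⟶ X} (α : f ⟶ g) :
    s.cell (x ≫ s.core₂.map s.core₁ (s.arr.lift α)) = wL (x ≫ s.core₂.ι) (Arrow.mk α) := by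
  change wL ((x ≫ _) ≫ s.core₁.ι) (Arrow.mk s.arr.cell) = _
  rw [Strict.assoc, StrictCore.map_ι, ← Strict.assoc, wL_comp, ArrowObj.wL_lift]

theorem cell_π₀₁ {A : C} (x : A ⟶ s.core₂.obj) :
    s.cell (x ≫ s.π₀₁) = wL (x ≫ s.core₂.ι) (Arrow.mk s.tri.cell₀₁) := s.cell_face x _

theorem cell_π₁₂ {A : C} (x : A ⟶ s.core₂.obj) :
    s.cell (x ≫ s.π₁₂) = wL (x ≫ s.core₂.ι) (Arrow.mk s.tri.cell₁₂) := s.cell_face x _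

theorem comp_π₀_π₁ {A : C} (x : A ⟶ s.core₂.obj) : (x ≫ s.π₀₁) ≫ s.π₁ = (x ≫ s.π₁₂) ≫ s.π₀ := by
  apply s.core₀.hom_ext
  rw [← cell_left, ← cell_right, cell_π₀₁, cell_π₁₂]
  rfl

theorem cell_composable {A : C} {x y : A ⟶ s.core₁.obj} (h : x ≫ s.π₁ = y ≫ s.π₀) :
    (s.cell x).right = (s.cell y).left := by
  rw [cell_left, cell_right, h]

theorem cell_π₀₂ {A : C} (x : A ⟶ s.core₂.obj) :
    s.cell (x ≫ s.π₀₂) = acomp (s.cell (x ≫ s.π₀₁)) (s.cell (x ≫ s.π₁₂))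
      (s.cell_composable (s.comp_π₀_π₁ x)) := by
  have h : s.cell (x ≫ s.π₀₂) = _ := s.cell_face x (s.tri.cell₀₁ ≫ s.tri.cell₁₂)
  rw [h, ← acomp_mk, wL_acomp]
  exact acomp_congr _ (s.cell_π₀₁ x).symm (s.cell_π₁₂ x).symm

theorem isArrowwiseIso_left {A : C} (x : A ⟶ s.core₁.obj) : IsArrowwiseIso (s.cell x).left :=
  (s.core₁.isArrowwiseIso.precomp x).comp _

theorem isArrowwiseIso_right {A : C} (x : A ⟶ s.core₁.obj) : IsArrowwiseIso (s.cell x).right :=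
  (s.core₁.isArrowwiseIso.precomp x).comp _

theorem existsUnique_comp {A : C} (x y : A ⟶ s.core₁.obj) (h : x ≫ s.π₁ = y ≫ s.π₀) :
    ∃! z : A ⟶ s.core₂.obj, z ≫ s.π₀₁ = x ∧ z ≫ s.π₁₂ = y := by
  obtain ⟨p, ⟨hp₁, hp₂⟩, hp⟩ := s.tri.existsUnique_map (s.cell x).hom
    (eqToHom (s.cell_composable h) ≫ (s.cell y).hom)
  rw [Arrow.arrow_mk_eqToHom_comp] at hp₂
  have hpa : IsArrowwiseIso p := by
    apply s.tri.isArrowwiseIso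
    · have : p ≫ s.tri.d₀ = (s.cell x).left := congrArg Arrow.left hp₁
      rw [this]; exact s.isArrowwiseIso_left x
    · have : p ≫ s.tri.d₁ = (s.cell x).right := congrArg Arrow.right hp₁
      rw [this]; exact s.isArrowwiseIso_right x
    · have : p ≫ s.tri.d₂ = (s.cell y).right := congrArg Arrow.right hp₂
      rw [this]; exact s.isArrowwiseIso_right y
  refine ⟨s.core₂.lift p hpa, ⟨?_, ?_⟩, ?_⟩
  · apply s.cell_ext
    rw [cell_π₀₁, StrictCore.lift_ι]
    exact hp₁
  · apply s.cell_ext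
    rw [cell_π₁₂, StrictCore.lift_ι]
    exact hp₂
  · rintro z ⟨hz₁, hz₂⟩
    apply s.core₂.hom_ext
    rw [StrictCore.lift_ι]
    apply hp
    constructor
    · change wL _ (Arrow.mk _) = _
      rw [← cell_π₀₁, hz₁]; rfl
    · rw [Arrow.arrow_mk_eqToHom_comp]
      change wL _ (Arrow.mk _) = _
      rw [← cell_π₁₂, hz₂]; rfl

theorem nerve_isPullback : IsPullback s.π₀₁ s.π₁₂ s.π₁ s.π₀ where
  w := by simpa using s.comp_π₀_π₁ (𝟙 _)
  isLimit' := by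
    refine ⟨Limits.PullbackCone.IsLimit.mk _
      (fun c => (s.existsUnique_comp c.fst c.snd c.condition).choose)
      (fun c => (s.existsUnique_comp c.fst c.snd c.condition).choose_spec.1.1)
      (fun c => (s.existsUnique_comp c.fst c.snd c.condition).choose_spec.1.2)
      (fun c m h₁ h₂ => (s.existsUnique_comp c.fst c.snd c.condition).choose_spec.2 m ⟨h₁, h₂⟩)⟩

/-- The diagram underlying the nerve. -/
noncomputable def nerveStruct : InternalCatStruct C where
  C₀ := s.core₀.obj
  C₁ := s.core₁.obj
  C₂ := s.core₂.obj
  π₀ := s.π₀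
  π₁ := s.π₁
  e := s.e
  π₀₁ := s.π₀₁
  π₁₂ := s.π₁₂
  π₀₂ := s.π₀₂
  isPullback := s.nerve_isPullback
  e_π₀ := by
    apply s.core₀.hom_ext
    have := congrArg Arrow.left (s.cell_e (𝟙 _))
    simpa [cell_left] using this
  e_π₁ := by
    apply s.core₀.hom_ext
    have := congrArg Arrow.right (s.cell_e (𝟙 _))
    simpa [cell_right] using this
  π₀₂_π₀ := by
    apply s.core₀.hom_ext
    have := congrArg Arrow.left (s.cell_π₀₂ (𝟙 _))
    simpa [cell_left] using this
  π₀₂_π₁ := by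
    apply s.core₀.hom_ext
    have := congrArg Arrow.right (s.cell_π₀₂ (𝟙 _))
    simpa [cell_right] using this

theorem cell_mul {A : C} (x y : A ⟶ s.core₁.obj) (h : x ≫ s.π₁ = y ≫ s.π₀) :
    s.cell (s.nerveStruct.mul x y h) = acomp (s.cell x) (s.cell y) (s.cell_composable h) := by
  have h₁ : s.nerve_isPullback.lift x y h ≫ s.π₀₁ = x := s.nerve_isPullback.lift_fst _ _ _
  have h₂ : s.nerve_isPullback.lift x y h ≫ s.π₁₂ = y := s.nerve_isPullback.lift_snd _ _ _
  refine (s.cell_π₀₂ (s.nerve_isPullback.lift x y h)).trans ?_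
  exact acomp_congr _ (congrArg s.cell h₁) (congrArg s.cell h₂)

/-- The nerve of `X` determined by the given choices. -/
noncomputable def nerve : InternalCat C where
  toInternalCatStruct := s.nerveStruct
  e_mul x := by
    apply s.cell_ext
    refine (s.cell_mul _ _ _).trans ?_
    refine (acomp_congr _ (s.cell_π₀_e x) rfl).trans ?_
    exact id_acomp _ _ _
  mul_e x := by
    apply s.cell_ext
    refine (s.cell_mul _ _ _).trans ?_
    refine (acomp_congr _ rfl (s.cell_π₁_e x)).trans ?_
    exact acomp_id _ _ _
  mul_assoc x y z hxy hyz := by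
    apply s.cell_ext
    refine (s.cell_mul _ _ _).trans ?_
    refine Eq.trans ?_ (s.cell_mul _ _ _).symm
    refine (acomp_congr _ (s.cell_mul x y hxy) rfl).trans ?_
    refine Eq.trans ?_ (acomp_congr _ rfl (s.cell_mul y z hyz)).symm
    exact acomp_assoc _ _ _ _ _

theorem wL_tautologicalCell {A : C} (x : A ⟶ s.core₁.obj) :
    wL x (Arrow.mk s.tautologicalCell) = s.cell x := by
  rw [mk_tautologicalCell, cell_eq]

/-- The tautological cocone under the nerve of `X`, with vertex `X`. -/
noncomputable def tautologicalCocone : Cocone s.nerve X where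
  γ := s.core₀.ι
  γ₀₁ := s.tautologicalCell
  unit := by
    exact (s.wL_tautologicalCell s.e).trans s.cell_e₁
  mul := by
    refine (s.wL_tautologicalCell s.π₀₂).trans ?_
    have h := s.cell_π₀₂ (𝟙 _)
    simp only [Category.id_comp] at h
    rw [h]
    exact acomp_congr _ (s.wL_tautologicalCell s.π₀₁).symm (s.wL_tautologicalCell s.π₁₂).symm

/-- The object part `f^≅` of the internal functor `Nv(f)`. -/
noncomputable def map₀ (f : X ⟶ Y) : s.core₀.obj ⟶ t.core₀.obj := s.core₀.map t.core₀ f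

/-- The arrow part `(f^→)^≅` of the internal functor `Nv(f)`. -/
noncomputable def map₁ (f : X ⟶ Y) : s.core₁.obj ⟶ t.core₁.obj :=
  s.core₁.map t.core₁ (s.arr.map t.arr f)

theorem comp_map₀_ι (f : X ⟶ Y) {A : C} (x : A ⟶ s.core₀.obj) :
    (x ≫ s.map₀ t f) ≫ t.core₀.ι = (x ≫ s.core₀.ι) ≫ f := by
  simp [map₀]

theorem cell_map₁ (f : X ⟶ Y) {A : C} (x : A ⟶ s.core₁.obj) :
    t.cell (x ≫ s.map₁ t f) = wR (s.cell x) f := by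
  change wL ((x ≫ s.map₁ t f) ≫ t.core₁.ι) (Arrow.mk t.arr.cell) = _
  rw [Strict.assoc, map₁, StrictCore.map_ι, ← Strict.assoc, wL_comp, ArrowObj.map,
    ArrowObj.wL_lift, mk_wR, wL_wR]
  rfl

theorem map₁_π₀ (f : X ⟶ Y) {A : C} (x : A ⟶ s.core₁.obj) :
    (x ≫ s.map₁ t f) ≫ t.π₀ = (x ≫ s.π₀) ≫ s.map₀ t f := by
  apply t.core₀.hom_ext
  rw [← cell_left, cell_map₁, comp_map₀_ι, ← cell_left]
  rfl

theorem map₁_π₁ (f : X ⟶ Y) {A : C} (x : A ⟶ s.core₁.obj) :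
    (x ≫ s.map₁ t f) ≫ t.π₁ = (x ≫ s.π₁) ≫ s.map₀ t f := by
  apply t.core₀.hom_ext
  rw [← cell_right, cell_map₁, comp_map₀_ι, ← cell_right]
  rfl

theorem map₁_π₀' (f : X ⟶ Y) : s.map₁ t f ≫ t.π₀ = s.π₀ ≫ s.map₀ t f := by
  simpa using s.map₁_π₀ t f (𝟙 _)

theorem map₁_π₁' (f : X ⟶ Y) : s.map₁ t f ≫ t.π₁ = s.π₁ ≫ s.map₀ t f := by
  simpa using s.map₁_π₁ t f (𝟙 _)

/-- The internal functor `Nv(f)`. -/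
noncomputable def nerveMap (f : X ⟶ Y) : s.nerve ⟶ t.nerve :=
  InternalCat.Hom.mk (I := s.nerve) (J := t.nerve) (s.map₀ t f) (s.map₁ t f)
    (s.map₁_π₀' t f)
    (s.map₁_π₁' t f)
    (by
      apply t.cell_ext
      refine (s.cell_map₁ t f s.e).trans ?_
      refine Eq.trans ?_ (t.cell_e (s.map₀ t f)).symm
      have h' : s.map₀ t f ≫ t.core₀.ι = s.core₀.ι ≫ f := s.core₀.map_ι t.core₀ f
      rw [cell_e₁, h', wR_mk_id])
    (by
      apply t.cell_ext
      refine (s.cell_map₁ t f s.π₀₂).trans ?_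
      refine Eq.trans ?_ (t.cell_mul _ _ _).symm
      have h := s.cell_π₀₂ (𝟙 _)
      simp only [Category.id_comp] at h
      rw [h, wR_acomp]
      exact acomp_congr _ (s.cell_map₁ t f s.π₀₁).symm (s.cell_map₁ t f s.π₁₂).symm)

/-- The morphism `Nv(α) : X^≅ ⟶ (Y^→)^≅`: the unique one with `Nv(α) ι ∂ = ι α`. -/
noncomputable def map₂ {f g : X ⟶ Y} (α : f ⟶ g) : s.core₀.obj ⟶ t.core₁.obj :=
  t.lift₁ (s.core₀.ι ◁ α) (s.core₀.isArrowwiseIso.comp f) (s.core₀.isArrowwiseIso.comp g)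

theorem cell_map₂ {f g : X ⟶ Y} (α : f ⟶ g) {A : C} (x : A ⟶ s.core₀.obj) :
    t.cell (x ≫ s.map₂ t α) = wL (x ≫ s.core₀.ι) (Arrow.mk α) := by
  rw [cell_comp, map₂, cell_lift₁, mk_wL, wL_comp]

theorem map₂_π₀ {f g : X ⟶ Y} (α : f ⟶ g) {A : C} (x : A ⟶ s.core₀.obj) :
    (x ≫ s.map₂ t α) ≫ t.π₀ = x ≫ s.map₀ t f := by
  apply t.core₀.hom_ext
  rw [← cell_left, cell_map₂, comp_map₀_ι]
  rfl

theorem map₂_π₁ {f g : X ⟶ Y} (α : f ⟶ g) {A : C} (x : A ⟶ s.core₀.obj) :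
    (x ≫ s.map₂ t α) ≫ t.π₁ = x ≫ s.map₀ t g := by
  apply t.core₀.hom_ext
  rw [← cell_right, cell_map₂, comp_map₀_ι]
  rfl

theorem map₂_π₀' {f g : X ⟶ Y} (α : f ⟶ g) : s.map₂ t α ≫ t.π₀ = s.map₀ t f := by
  simpa using s.map₂_π₀ t α (𝟙 _)

theorem map₂_π₁' {f g : X ⟶ Y} (α : f ⟶ g) : s.map₂ t α ≫ t.π₁ = s.map₀ t g := by
  simpa using s.map₂_π₁ t α (𝟙 _)

/-- The internal natural transformation `Nv(α)`. -/
noncomputable def nerveMap₂ {f g : X ⟶ Y} (α : f ⟶ g) : s.nerveMap t f ⟶ s.nerveMap t g :=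
  InternalCat.NatTrans.mk (F := s.nerveMap t f) (G := s.nerveMap t g) (s.map₂ t α)
    (s.map₂_π₀' t α)
    (s.map₂_π₁' t α)
    (by
      apply t.cell_ext
      refine (t.cell_mul _ _ _).trans ?_
      refine Eq.trans ?_ (t.cell_mul _ _ _).symm
      have h₁ : t.cell (s.map₁ t f) = wR (s.cell (𝟙 _)) f := by
        simpa using s.cell_map₁ t f (𝟙 _)
      have h₁' : t.cell (s.map₁ t g) = wR (s.cell (𝟙 _)) g := by
        simpa using s.cell_map₁ t g (𝟙 _)
      have h₂ : t.cell (s.π₁ ≫ s.map₂ t α) = wL (s.cell (𝟙 _)).right (Arrow.mk α) := by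
        rw [cell_map₂, cell_right]; simp
      have h₂' : t.cell (s.π₀ ≫ s.map₂ t α) = wL (s.cell (𝟙 _)).left (Arrow.mk α) := by
        rw [cell_map₂, cell_left]; simp
      refine (acomp_congr _ h₁ h₂).trans ?_
      refine Eq.trans ?_ (acomp_congr _ h₂' h₁').symm
      exact (exchange (s.cell (𝟙 _)) (Arrow.mk α)).symm)

/-- The functor from the category of morphisms `X ⟶ Y` to that of internal functors from a nerve of
`X` to a nerve of `Y`, given by the nerve construction. -/
noncomputable def nerveHom : (X ⟶ Y) ⥤ (s.nerve ⟶ t.nerve) where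
  obj f := s.nerveMap t f
  map α := s.nerveMap₂ t α
  map_id f := by
    apply InternalCat.nat_ext
    apply t.cell_ext
    have h := s.cell_map₂ t (𝟙 f) (𝟙 _)
    have h' := s.comp_map₀_ι t f (𝟙 _)
    simp only [Category.id_comp] at h h'
    refine h.trans ?_
    refine Eq.trans ?_ (t.cell_e (s.map₀ t f)).symm
    rw [wL_mk_id, h']
  map_comp {f g h} α β := by
    apply InternalCat.nat_ext
    apply t.cell_ext
    refine Eq.trans ?_ (t.cell_mul _ _ _).symm
    have key : ∀ {f g : X ⟶ Y} (α : f ⟶ g), t.cell (s.map₂ t α) = wL s.core₀.ι (Arrow.mk α) := by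
      intro f g α
      simpa using s.cell_map₂ t α (𝟙 _)
    refine (key _).trans ?_
    refine Eq.trans ?_ (acomp_congr _ (key α) (key β)).symm
    rw [← acomp_mk, wL_acomp]

theorem nerveMap_id : s.nerveMap s (𝟙 X) = 𝟙 s.nerve := by
  apply InternalCat.hom_ext
  · apply s.core₀.hom_ext
    refine (s.core₀.map_ι s.core₀ (𝟙 X)).trans ?_
    refine (Strict.comp_id _).trans ?_
    exact (Strict.id_comp _).symm
  · apply s.cell_ext
    have h := s.cell_map₁ s (𝟙 X) (𝟙 _)
    rw [Strict.id_comp, wR_id] at h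
    exact h

theorem nerveMap_comp (r : NerveSpec Z) (f : X ⟶ Y) (g : Y ⟶ Z) :
    s.nerveMap r (f ≫ g) = s.nerveMap t f ≫ t.nerveMap r g := by
  apply InternalCat.hom_ext
  · apply r.core₀.hom_ext
    have h := s.comp_map₀_ι t f (𝟙 _)
    have h' := s.comp_map₀_ι r (f ≫ g) (𝟙 _)
    rw [Strict.id_comp, Strict.id_comp] at h h'
    refine h'.trans ?_
    refine Eq.trans ?_ (t.comp_map₀_ι r g (s.map₀ t f)).symm
    rw [h, Strict.assoc]
  · apply r.cell_ext
    have h := s.cell_map₁ t f (𝟙 _)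
    have h' := s.cell_map₁ r (f ≫ g) (𝟙 _)
    rw [Strict.id_comp] at h h'
    refine h'.trans ?_
    refine Eq.trans ?_ (t.cell_map₁ r g (s.map₁ t f)).symm
    rw [h, wR_comp]

end NerveSpec

variable [Bicategory.Strict C]

/-- The nerve 2-functor from `C` to the 2-category of internal categories in the underlying
1-category of `C`, for a choice `σ` of the data determining a nerve of each object. -/
noncomputable def nerveFunctor (σ : ∀ X : C, NerveSpec X) :
    StrictPseudofunctor C (InternalCat C) :=
  StrictPseudofunctor.mk''
    { obj := fun X => (σ X).nerve
      map := fun {X Y} f => (σ X).nerveMap (σ Y) f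
      map₂ := fun {X Y _ _} α => (σ X).nerveMap₂ (σ Y) α
      map₂_id := fun {X Y} f => ((σ X).nerveHom (σ Y)).map_id f
      map₂_comp := fun {X Y _ _ _} α β => ((σ X).nerveHom (σ Y)).map_comp α β
      map_id := fun X => (σ X).nerveMap_id
      map_comp := fun {X Y Z} f g => (σ X).nerveMap_comp (σ Y) (σ Z) f g
      map₂_whisker_left := fun {X Y Z} f g g' η => by
        apply InternalCat.nat_ext
        rw [InternalCat.eqToHom_comp_app, InternalCat.comp_eqToHom_app]
        apply (σ Z).cell_ext
        have h := (σ X).cell_map₂ (σ Z) (f ◁ η) (𝟙 _)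
        have h' := (σ X).comp_map₀_ι (σ Y) f (𝟙 _)
        rw [Strict.id_comp, Strict.id_comp] at h h'
        refine h.trans ?_
        refine Eq.trans ?_ ((σ Y).cell_map₂ (σ Z) η ((σ X).map₀ (σ Y) f)).symm
        rw [h', wL_comp, mk_wL]
      map₂_whisker_right := fun {X Y Z f f'} η g => by
        apply InternalCat.nat_ext
        rw [InternalCat.eqToHom_comp_app, InternalCat.comp_eqToHom_app]
        apply (σ Z).cell_ext
        have h := (σ X).cell_map₂ (σ Z) (η ▷ g) (𝟙 _)
        have h' := (σ X).cell_map₂ (σ Y) η (𝟙 _)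
        rw [Strict.id_comp, Strict.id_comp] at h h'
        refine h.trans ?_
        refine Eq.trans ?_ ((σ Y).cell_map₁ (σ Z) g ((σ X).map₂ (σ Y) η)).symm
        rw [h', mk_wR, wL_wR] }

theorem inducedHom_conj {B D : Type*} [Bicategory D] {F : B → D} {X Y : InducedBicategory D F}
    {f f' g g' : X ⟶ Y} (p : f = f') (η : f' ⟶ g') (q : g' = g) :
    (eqToHom p ≫ η ≫ eqToHom q).hom = eqToHom (congrArg InducedBicategory.Hom.hom p) ≫ η.hom ≫
      eqToHom (congrArg InducedBicategory.Hom.hom q) := by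
  subst p q
  simp

/-- The nerve 2-functor `Nv : C ⟶ Cong(C)`, given that nerves are complete congruences. -/
noncomputable def Nv (σ : ∀ X : C, NerveSpec X)
    (h : ∀ X : C, IsCompleteCongruence (σ X).nerve) : StrictPseudofunctor C (Cong C) :=
  StrictPseudofunctor.mk''
    { obj := fun X => ⟨(σ X).nerve, h X⟩
      map := fun f => InducedBicategory.mkHom ((nerveFunctor σ).map f)
      map₂ := fun α => InducedBicategory.mkHom₂ ((nerveFunctor σ).map₂ α)
      map₂_id := fun f => by
        ext
        exact (nerveFunctor σ).map₂_id f
      map₂_comp := fun α β => by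
        ext
        exact (nerveFunctor σ).map₂_comp α β
      map_id := fun X => by
        ext
        exact (nerveFunctor σ).map_id X
      map_comp := fun f g => by
        ext
        exact (nerveFunctor σ).map_comp f g
      map₂_whisker_left := fun f g g' η => by
        ext
        refine Eq.trans ?_ (inducedHom_conj _ _ _).symm
        have e := (nerveFunctor σ).map₂_whisker_left f η
        simp only [StrictPseudofunctor.mapComp_eq_eqToIso, eqToIso.hom, eqToIso.inv] at e
        exact e
      map₂_whisker_right := fun η g => by
        ext
        refine Eq.trans ?_ (inducedHom_conj _ _ _).symm
        have e := (nerveFunctor σ).map₂_whisker_right η g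
        simp only [StrictPseudofunctor.mapComp_eq_eqToIso, eqToIso.hom, eqToIso.inv] at e
        exact e }

/-- `I` is a nerve of some object. -/
def IsNerve (I : InternalCat C) : Prop :=
  ∃ (X : C) (s : NerveSpec X), s.nerve = I

variable (C) in
/-- Groupoidant 2-categories. -/
structure IsGroupoidant : Prop where
  /-- `C` has pita limits. -/
  pita : IsPita C
  /-- `C` has strict cores. -/
  cores : ∀ X : C, Nonempty (StrictCore X)
  /-- Every complete congruence in `C` is a nerve. -/
  nerves : ∀ I : InternalCat C, IsCompleteCongruence I → IsNerve I
  /-- The tautological cocone under any nerve is a strict quotient. -/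
  quotients : ∀ (X : C) (s : NerveSpec X), s.tautologicalCocone.IsStrictQuotient

end Nerves

/-! ### Strict equivalences of 2-categories -/

section Equivalences

/-- Two objects of a 2-category are equivalent. -/
def AreEquivalent {D : Type*} [Bicategory D] (X Y : D) : Prop :=
  ∃ (f : X ⟶ Y) (g : Y ⟶ X), Nonempty (f ≫ g ≅ 𝟙 X) ∧ Nonempty (g ≫ f ≅ 𝟙 Y)

/-- A 2-functor is a strict equivalence if it is essentially surjective (up to equivalence) and
induces isomorphisms of hom categories. -/
structure IsStrictEquivalence {C D : Type*} [Bicategory C] [Bicategory D]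
    (F : StrictPseudofunctor C D) : Prop where
  essSurj : ∀ Z : D, ∃ X : C, AreEquivalent (F.obj X) Z
  strictlyFullyFaithful : ∀ X Y : C, IsIsoOfCats (F.mapFunctor X Y)

end Equivalences

end TwoCat

/-!
The nerve of `X` represents, over each `A`, the category whose objects are the arrow-wise
isomorphisms `A ⟶ X` and whose arrows are all 2-cells between them: its object of arrows is
`(X^→)^≅`, and a morphism into it is such a 2-cell (`NerveSpec.cell`). Everything is computed with
these 2-cells, viewed as elements of `Arrow (A ⟶ X)`, so that the strict associativity and unit laws
hold on the nose and no coherence morphisms appear.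

*Existence of nerves.* The cotensor `X^[2]` is the pullback of `d₁ : X^→ ⟶ X` along
`d₀ : X^→ ⟶ X`, which exists as `d₁` is an isofibration (`IsPita.nonempty_triangleObj`).

*Nerves are complete congruences.* Cores are groupoidal. A 2-cell into `(X^→)^≅` is a commuting
square of 2-cells into `X` with two invertible sides (`NerveSpec.cell_naturality`,
`NerveSpec.exists_hom₁`, `NerveSpec.arrow_ext₁`). Hence a 2-cell into `X` can be transported
uniquely along 2-cells of `X^≅` at its two ends, which is the discrete opfibration property
(`NerveSpec.isDOF_pair`). Completeness holds because a composable triple `(u, v, w)` with `uv` and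
`vw` identities is an invertible 2-cell `u = w` with its inverse `v`, and invertible 2-cells between
arrow-wise isomorphisms are precisely the 2-cells of `X^≅` (`NerveSpec.exists_ofCore_of_mul_eq_e`,
`NerveSpec.isRezkComplete`).

*The equivalence.* Composing an internal functor from a nerve of `X` to a nerve of `Y` with the
tautological cocone of `Y` gives a cocone under the nerve of `X` with vertex `Y`, which determines
the functor; internal transformations correspond to morphisms of cocones. As the tautological cocone of
`X` is a strict quotient, the cocone is induced by a unique morphism `X ⟶ Y`, and so the functors on
hom categories are isomorphisms (`NerveSpec.isIsoOfCats_nerveHom`). Essential surjectivity holds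
since every complete congruence is a nerve of some `X`, and any two nerves of `X` are isomorphic via
`Nv(𝟙 X)` (`areEquivalent_of_nerves`).
-/

namespace TwoCat

/-! ### Composition of arrows up to equality of objects -/

section Arrows

variable {D : Type*} [Category D]

theorem exists_arrow_mk_eq (a : Arrow D) {x y : D} (hx : a.left = x) (hy : a.right = y) :
    ∃ f : x ⟶ y, Arrow.mk f = a := by
  subst hx hy
  exact ⟨a.hom, rfl⟩

theorem eq_id_of_arrow_mk_eq {x y : D} {f : x ⟶ x} (h : Arrow.mk f = Arrow.mk (𝟙 y)) :
    f = 𝟙 x := by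
  obtain rfl : x = y := congrArg Arrow.left h
  exact Arrow.mk_injective _ _ h

/-- Two one-sided inverses of `b` agree, and are then invertible. -/
theorem eq_and_isIso_of_acomp_eq_id {a b c : Arrow D} {h : a.right = b.left}
    {k : b.right = c.left} {x y : D} (hab : acomp a b h = Arrow.mk (𝟙 x))
    (hbc : acomp b c k = Arrow.mk (𝟙 y)) : a = c ∧ IsIso a.hom := by
  have hx : x = c.left := (congrArg Arrow.right hab).symm.trans k
  have hy : a.right = y := h.trans (congrArg Arrow.left hbc)
  have hac : a = c := by
    rw [← acomp_id y a hy, acomp_congr hy rfl hbc.symm, ← acomp_assoc _ _ _ h k]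
    exact (acomp_congr _ hab rfl).trans (id_acomp x c hx)
  subst hac
  refine ⟨rfl, ?_⟩
  obtain ⟨x₁, x₂, f, rfl⟩ := Arrow.mk_surjective a
  obtain ⟨y₁, y₂, g, rfl⟩ := Arrow.mk_surjective b
  dsimp at h k
  subst h k
  exact ⟨g, eq_id_of_arrow_mk_eq ((acomp_mk f g).symm.trans hab),
    eq_id_of_arrow_mk_eq ((acomp_mk g f).symm.trans hbc)⟩

theorem isIso_of_arrow_mk_eq {x y : D} {f : x ⟶ y} {a : Arrow D} (h : Arrow.mk f = a)
    (ha : IsIso a.hom) : IsIso f := by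
  subst h
  exact ha

theorem sigma_eq_of_arrow_mk_eq {x y y' : D} {p : x ⟶ y} {p' : x ⟶ y'}
    (h : Arrow.mk p = Arrow.mk p') : (⟨y, p⟩ : Σ z, (x ⟶ z)) = ⟨y', p'⟩ := by
  obtain rfl : y = y' := congrArg Arrow.right h
  obtain rfl := Arrow.mk_injective _ _ h
  rfl

theorem acomp_inv_acomp (a b : Arrow D) [IsIso a.hom] (h : a.left = b.left) :
    acomp a (acomp (Arrow.mk (inv a.hom)) b h) rfl = b := by
  have e : acomp a (acomp (Arrow.mk (inv a.hom)) b h) rfl = Arrow.mk (eqToHom h ≫ b.hom) := by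
    simp [acomp]
  rw [e, Arrow.arrow_mk_eqToHom_comp]
  rfl

theorem acomp_left_cancel {a b c : Arrow D} (ha : IsIso a.hom) {h : a.right = b.left}
    {k : a.right = c.left} (e : acomp a b h = acomp a c k) : b = c := by
  obtain ⟨x, y, f, rfl⟩ := Arrow.mk_surjective a
  obtain ⟨y₁, z₁, g, rfl⟩ := Arrow.mk_surjective b
  obtain ⟨y₂, z₂, g', rfl⟩ := Arrow.mk_surjective c
  dsimp at h k
  subst h k
  obtain rfl : z₁ = z₂ := congrArg Arrow.right e
  have : IsIso f := ha
  have e' := (acomp_mk f g).symm.trans (e.trans (acomp_mk f g'))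
  rw [(cancel_epi f).1 (Arrow.mk_injective _ _ e')]

theorem arrow_mk_inv_congr {a b a' b' : D} {q : a ⟶ b} {q' : a' ⟶ b'} [IsIso q] [IsIso q']
    (e : Arrow.mk q = Arrow.mk q') : Arrow.mk (inv q) = Arrow.mk (inv q') := by
  obtain rfl : a = a' := congrArg Arrow.left e
  obtain rfl : b = b' := congrArg Arrow.right e
  obtain rfl := Arrow.mk_injective _ _ e
  rfl

end Arrows

/-! ### Two-dimensional universal properties for arrows of hom categories -/

section Limits

variable {C : Type u} [Bicategory.{w, v} C]

theorem isIso_wR_hom {A X Y : C} (a : Arrow (A ⟶ X)) (ha : IsIso a.hom) (f : X ⟶ Y) :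
    IsIso (wR a f).hom := by
  change IsIso (a.hom ▷ f)
  infer_instance

theorem isIsofibration_of_lift {X Y : C} {f : X ⟶ Y}
    (h : ∀ {A : C} (x : A ⟶ X) (b : A ⟶ Y) (β : x ≫ f ⟶ b), IsIso β →
      ∃ (y : A ⟶ X) (p : x ⟶ y), IsIso p ∧ Arrow.mk (p ▷ f) = Arrow.mk β) :
    IsIsofibration f :=
  fun _ x b β hβ => h x b β hβ

theorem IsIsofibration.exists_lift {X Y : C} {f : X ⟶ Y} (hf : IsIsofibration f) {A : C}
    (x : A ⟶ X) (b : A ⟶ Y) (β : x ≫ f ⟶ b) (hβ : IsIso β) :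
    ∃ (y : A ⟶ X) (p : x ⟶ y), IsIso p ∧ Arrow.mk (p ▷ f) = Arrow.mk β :=
  hf A x b β hβ

theorem StrictCore.arrow_ext {X : C} (c : StrictCore X) {A : C} {a b : Arrow (A ⟶ c.obj)}
    (h : wR a c.ι = wR b c.ι) : a = b := by
  obtain ⟨x, y, f, rfl⟩ := Arrow.mk_surjective a
  obtain ⟨x', y', f', rfl⟩ := Arrow.mk_surjective b
  obtain rfl : x = x' := c.hom_ext (congrArg Arrow.left h)
  obtain rfl : y = y' := c.hom_ext (congrArg Arrow.right h)
  have e : f ▷ c.ι = f' ▷ c.ι := Arrow.mk_injective _ _ h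
  rw [(c.existsUnique_cell x y (f' ▷ c.ι) (c.isArrowwiseIso f')).unique e rfl]

/-- Invertible 2-cells between arrow-wise isomorphisms lift to the core. -/
theorem StrictCore.exists_arrow {X : C} (c : StrictCore X) {A : C} (b : Arrow (A ⟶ X))
    (hb : IsIso b.hom) (hl : IsArrowwiseIso b.left) (hr : IsArrowwiseIso b.right) :
    ∃ a : Arrow (A ⟶ c.obj), wR a c.ι = b := by
  obtain ⟨x, y, f, rfl⟩ := Arrow.mk_surjective b
  obtain ⟨x, rfl, -⟩ := c.existsUnique_map _ hl
  obtain ⟨y, rfl, -⟩ := c.existsUnique_map _ hr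
  obtain ⟨φ, hφ, -⟩ := c.existsUnique_cell x y f hb
  exact ⟨Arrow.mk φ, congrArg Arrow.mk hφ⟩

theorem StrictCore.isGroupoidal {X : C} (c : StrictCore X) : IsGroupoidal c.obj := by
  intro A f g α
  have := c.isArrowwiseIso α
  obtain ⟨φ, hφ, -⟩ := c.existsUnique_cell g f (inv (α ▷ c.ι)) inferInstance
  refine ⟨φ, ?_, ?_⟩
  · refine (c.existsUnique_cell f f (𝟙 _) inferInstance).unique ?_ (by simp)
    simp [hφ]
  · refine (c.existsUnique_cell g g (𝟙 _) inferInstance).unique ?_ (by simp)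
    simp [hφ]

theorem ArrowObj.arrow_ext {X : C} (o : ArrowObj X) {A : C} {a b : Arrow (A ⟶ o.obj)}
    (hl : a.left = b.left) (hr : a.right = b.right) (h₀ : wR a o.d₀ = wR b o.d₀)
    (h₁ : wR a o.d₁ = wR b o.d₁) : a = b := by
  obtain ⟨x, y, f, rfl⟩ := Arrow.mk_surjective a
  obtain ⟨x', y', f', rfl⟩ := Arrow.mk_surjective b
  dsimp at hl hr
  subst hl hr
  have e₀ : f ▷ o.d₀ = f' ▷ o.d₀ := Arrow.mk_injective _ _ h₀
  have e₁ : f ▷ o.d₁ = f' ▷ o.d₁ := Arrow.mk_injective _ _ h₁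
  rw [(o.existsUnique_cell x y (f' ▷ o.d₀) (f' ▷ o.d₁)
    (whisker_exchange f' o.cell)).unique ⟨e₀, e₁⟩ ⟨rfl, rfl⟩]

theorem ArrowObj.exists_arrow {X : C} (o : ArrowObj X) {A : C} (x y : A ⟶ o.obj)
    (a₀ a₁ : Arrow (A ⟶ X)) (l₀ : a₀.left = x ≫ o.d₀) (r₀ : a₀.right = y ≫ o.d₀)
    (l₁ : a₁.left = x ≫ o.d₁) (r₁ : a₁.right = y ≫ o.d₁)
    (h : acomp (wL x (Arrow.mk o.cell)) a₁ l₁.symm = acomp a₀ (wL y (Arrow.mk o.cell)) r₀) :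
    ∃ θ : x ⟶ y, wR (Arrow.mk θ) o.d₀ = a₀ ∧ wR (Arrow.mk θ) o.d₁ = a₁ := by
  obtain ⟨p, q, f, rfl⟩ := Arrow.mk_surjective a₀
  obtain ⟨p', q', f', rfl⟩ := Arrow.mk_surjective a₁
  dsimp at l₀ r₀ l₁ r₁
  subst l₀ r₀ l₁ r₁
  have e := (acomp_mk (x ◁ o.cell) f').symm.trans (h.trans (acomp_mk f (y ◁ o.cell)))
  obtain ⟨θ, ⟨h₀, h₁⟩, -⟩ := o.existsUnique_cell x y f f' (Arrow.mk_injective _ _ e)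
  exact ⟨θ, congrArg Arrow.mk h₀, congrArg Arrow.mk h₁⟩

theorem TriangleObj.arrow_ext {X : C} (o : TriangleObj X) {A : C} {a b : Arrow (A ⟶ o.obj)}
    (hl : a.left = b.left) (hr : a.right = b.right) (h₀ : wR a o.d₀ = wR b o.d₀)
    (h₁ : wR a o.d₁ = wR b o.d₁) (h₂ : wR a o.d₂ = wR b o.d₂) : a = b := by
  obtain ⟨x, y, f, rfl⟩ := Arrow.mk_surjective a
  obtain ⟨x', y', f', rfl⟩ := Arrow.mk_surjective b
  dsimp at hl hr
  subst hl hr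
  have e₀ : f ▷ o.d₀ = f' ▷ o.d₀ := Arrow.mk_injective _ _ h₀
  have e₁ : f ▷ o.d₁ = f' ▷ o.d₁ := Arrow.mk_injective _ _ h₁
  have e₂ : f ▷ o.d₂ = f' ▷ o.d₂ := Arrow.mk_injective _ _ h₂
  rw [(o.existsUnique_cell x y (f' ▷ o.d₀) (f' ▷ o.d₁) (f' ▷ o.d₂)
    (whisker_exchange f' o.cell₀₁) (whisker_exchange f' o.cell₁₂)).unique
      ⟨e₀, e₁, e₂⟩ ⟨rfl, rfl, rfl⟩]

theorem TriangleObj.exists_arrow {X : C} (o : TriangleObj X) {A : C} (x y : A ⟶ o.obj)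
    (a₀ a₁ a₂ : Arrow (A ⟶ X)) (l₀ : a₀.left = x ≫ o.d₀) (r₀ : a₀.right = y ≫ o.d₀)
    (l₁ : a₁.left = x ≫ o.d₁) (r₁ : a₁.right = y ≫ o.d₁)
    (l₂ : a₂.left = x ≫ o.d₂) (r₂ : a₂.right = y ≫ o.d₂)
    (h : acomp (wL x (Arrow.mk o.cell₀₁)) a₁ l₁.symm = acomp a₀ (wL y (Arrow.mk o.cell₀₁)) r₀)
    (h' : acomp (wL x (Arrow.mk o.cell₁₂)) a₂ l₂.symm =
      acomp a₁ (wL y (Arrow.mk o.cell₁₂)) r₁) :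
    ∃ θ : x ⟶ y, wR (Arrow.mk θ) o.d₀ = a₀ ∧ wR (Arrow.mk θ) o.d₁ = a₁ ∧
      wR (Arrow.mk θ) o.d₂ = a₂ := by
  obtain ⟨p, q, f, rfl⟩ := Arrow.mk_surjective a₀
  obtain ⟨p', q', f', rfl⟩ := Arrow.mk_surjective a₁
  obtain ⟨p'', q'', f'', rfl⟩ := Arrow.mk_surjective a₂
  dsimp at l₀ r₀ l₁ r₁ l₂ r₂
  subst l₀ r₀ l₁ r₁ l₂ r₂
  have e := (acomp_mk (x ◁ o.cell₀₁) f').symm.trans (h.trans (acomp_mk f (y ◁ o.cell₀₁)))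
  have e' := (acomp_mk (x ◁ o.cell₁₂) f'').symm.trans (h'.trans (acomp_mk f' (y ◁ o.cell₁₂)))
  obtain ⟨θ, ⟨h₀, h₁, h₂⟩, -⟩ := o.existsUnique_cell x y f f' f'' (Arrow.mk_injective _ _ e)
    (Arrow.mk_injective _ _ e')
  exact ⟨θ, congrArg Arrow.mk h₀, congrArg Arrow.mk h₁, congrArg Arrow.mk h₂⟩

namespace StrictProd

variable {X Y : C} (P : StrictProd X Y)

@[simp] theorem pair_fst {B : C} (f : B ⟶ X) (g : B ⟶ Y) : P.pair f g ≫ P.fst = f :=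
  (P.existsUnique_map f g).choose_spec.1.1

@[simp] theorem pair_snd {B : C} (f : B ⟶ X) (g : B ⟶ Y) : P.pair f g ≫ P.snd = g :=
  (P.existsUnique_map f g).choose_spec.1.2

theorem hom_ext {B : C} {x y : B ⟶ P.obj} (h : x ≫ P.fst = y ≫ P.fst)
    (h' : x ≫ P.snd = y ≫ P.snd) : x = y :=
  (P.existsUnique_map (y ≫ P.fst) (y ≫ P.snd)).unique ⟨h, h'⟩ ⟨rfl, rfl⟩

theorem arrow_ext {B : C} {a b : Arrow (B ⟶ P.obj)} (h : wR a P.fst = wR b P.fst)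
    (h' : wR a P.snd = wR b P.snd) : a = b := by
  obtain ⟨x, y, f, rfl⟩ := Arrow.mk_surjective a
  obtain ⟨x', y', f', rfl⟩ := Arrow.mk_surjective b
  obtain rfl : x = x' := P.hom_ext (congrArg Arrow.left h) (congrArg Arrow.left h')
  obtain rfl : y = y' := P.hom_ext (congrArg Arrow.right h) (congrArg Arrow.right h')
  have e : f ▷ P.fst = f' ▷ P.fst := Arrow.mk_injective _ _ h
  have e' : f ▷ P.snd = f' ▷ P.snd := Arrow.mk_injective _ _ h'
  rw [(P.existsUnique_cell x y (f' ▷ P.fst) (f' ▷ P.snd)).unique ⟨e, e'⟩ ⟨rfl, rfl⟩]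

theorem wR_pair_fst [Bicategory.Strict C] {A B : C} (a : Arrow (A ⟶ B)) (f : B ⟶ X)
    (g : B ⟶ Y) : wR (wR a (P.pair f g)) P.fst = wR a f := by
  rw [← wR_comp, pair_fst]

theorem wR_pair_snd [Bicategory.Strict C] {A B : C} (a : Arrow (A ⟶ B)) (f : B ⟶ X)
    (g : B ⟶ Y) : wR (wR a (P.pair f g)) P.snd = wR a g := by
  rw [← wR_comp, pair_snd]

end StrictProd

namespace IsStrictPullback

variable {P X Y Z : C} {h : P ⟶ X} {k : P ⟶ Y} {f : X ⟶ Z} {g : Y ⟶ Z}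

theorem hom_ext (H : IsStrictPullback h k f g) {B : C} {x y : B ⟶ P} (e : x ≫ h = y ≫ h)
    (e' : x ≫ k = y ≫ k) (c : (y ≫ h) ≫ f = (y ≫ k) ≫ g) : x = y :=
  (H.existsUnique_map (y ≫ h) (y ≫ k) c).unique ⟨e, e'⟩ ⟨rfl, rfl⟩

variable [Bicategory.Strict C]

theorem comp_w (H : IsStrictPullback h k f g) {B : C} (y : B ⟶ P) :
    (y ≫ h) ≫ f = (y ≫ k) ≫ g := by
  rw [Strict.assoc, Strict.assoc, H.w]

theorem wR_w (H : IsStrictPullback h k f g) {B : C} (a : Arrow (B ⟶ P)) :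
    wR (wR a h) f = wR (wR a k) g := by
  rw [← wR_comp, ← wR_comp, H.w]

theorem arrow_ext (H : IsStrictPullback h k f g) {B : C} {a b : Arrow (B ⟶ P)}
    (e : wR a h = wR b h) (e' : wR a k = wR b k) : a = b := by
  obtain ⟨x, y, p, rfl⟩ := Arrow.mk_surjective a
  obtain ⟨x', y', p', rfl⟩ := Arrow.mk_surjective b
  obtain rfl : x = x' := H.hom_ext (congrArg Arrow.left e) (congrArg Arrow.left e') (H.comp_w _)
  obtain rfl : y = y' := H.hom_ext (congrArg Arrow.right e) (congrArg Arrow.right e') (H.comp_w _)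
  have e₁ : p ▷ h = p' ▷ h := Arrow.mk_injective _ _ e
  have e₂ : p ▷ k = p' ▷ k := Arrow.mk_injective _ _ e'
  rw [(H.existsUnique_cell x y (p' ▷ h) (p' ▷ k) (H.wR_w (Arrow.mk p'))).unique
    ⟨e₁, e₂⟩ ⟨rfl, rfl⟩]

/-- The two-dimensional part of the universal property of a strict pullback may be checked on
2-cells with unspecified domain and codomain. -/
theorem of_arrow (hw : h ≫ f = k ≫ g)
    (hmap : ∀ {B : C} (h' : B ⟶ X) (k' : B ⟶ Y), h' ≫ f = k' ≫ g →
      ∃! u : B ⟶ P, u ≫ h = h' ∧ u ≫ k = k')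
    (hext : ∀ {B : C} {a b : Arrow (B ⟶ P)}, a.left = b.left → a.right = b.right →
      wR a h = wR b h → wR a k = wR b k → a = b)
    (hex : ∀ {B : C} (u u' : B ⟶ P) (a : Arrow (B ⟶ X)) (b : Arrow (B ⟶ Y)),
      a.left = u ≫ h → a.right = u' ≫ h → b.left = u ≫ k → b.right = u' ≫ k →
      wR a f = wR b g → ∃ θ : u ⟶ u', wR (Arrow.mk θ) h = a ∧ wR (Arrow.mk θ) k = b) :
    IsStrictPullback h k f g where
  w := hw
  existsUnique_map := hmap
  existsUnique_cell u u' α β e := by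
    obtain ⟨θ, h₁, h₂⟩ := hex u u' (Arrow.mk α) (Arrow.mk β) rfl rfl rfl rfl e
    refine ⟨θ, ⟨Arrow.mk_injective _ _ h₁, Arrow.mk_injective _ _ h₂⟩, ?_⟩
    rintro φ ⟨h₁', h₂'⟩
    refine Arrow.mk_injective _ _ (hext rfl rfl (Eq.trans ?_ h₁.symm) (Eq.trans ?_ h₂.symm))
    · exact congrArg Arrow.mk h₁'
    · exact congrArg Arrow.mk h₂'

theorem isIso (H : IsStrictPullback h k f g) {B : C} {x y : B ⟶ P} (θ : x ⟶ y)
    (hh : IsIso (θ ▷ h)) (hk : IsIso (θ ▷ k)) : IsIso θ := by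
  obtain ⟨φ, ⟨h₁, h₂⟩, -⟩ := H.existsUnique_cell y x (inv (θ ▷ h)) (inv (θ ▷ k)) (by
    have e := arrow_mk_inv_congr (q := θ ▷ h ▷ f) (q' := θ ▷ k ▷ g) (H.wR_w (Arrow.mk θ))
    simpa using e)
  refine ⟨φ, ?_, ?_⟩
  · refine Arrow.mk_injective _ _ (H.arrow_ext ?_ ?_)
    · exact congrArg Arrow.mk (by simp [h₁])
    · exact congrArg Arrow.mk (by simp [h₂])
  · refine Arrow.mk_injective _ _ (H.arrow_ext ?_ ?_)
    · exact congrArg Arrow.mk (by simp [h₁])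
    · exact congrArg Arrow.mk (by simp [h₂])

/-- Isofibrations are stable under strict pullback. -/
theorem isIsofibration_snd (H : IsStrictPullback h k f g) (hf : IsIsofibration f) :
    IsIsofibration k := by
  refine isIsofibration_of_lift fun {A} x b β hβ => ?_
  obtain ⟨y, p, hp, e⟩ := hf.exists_lift (x ≫ h) (b ≫ g) (eqToHom (H.comp_w x) ≫ β ▷ g)
    inferInstance
  rw [Arrow.arrow_mk_eqToHom_comp] at e
  obtain ⟨u, ⟨rfl, rfl⟩, -⟩ := H.existsUnique_map y b (congrArg Arrow.right e)
  obtain ⟨θ, ⟨h₁, h₂⟩, -⟩ := H.existsUnique_cell x u p β e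
  exact ⟨u, θ, H.isIso θ (h₁ ▸ hp) (h₂ ▸ hβ), congrArg Arrow.mk h₂⟩

end IsStrictPullback

/-! ### Products and triangle objects from pita limits -/

theorem IsStrictTerminal.hom_eq {T : C} (hT : IsStrictTerminal T) {A : C} (f g : A ⟶ T) :
    f = g :=
  (hT A).1.some.eq_default f |>.trans ((hT A).1.some.eq_default g).symm

theorem IsStrictTerminal.arrow_eq {T : C} (hT : IsStrictTerminal T) {A : C}
    (a b : Arrow (A ⟶ T)) : a = b := by
  obtain ⟨x, y, p, rfl⟩ := Arrow.mk_surjective a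
  obtain ⟨x', y', p', rfl⟩ := Arrow.mk_surjective b
  obtain rfl := hT.hom_eq x x'
  obtain rfl := hT.hom_eq y y'
  have := ((hT A).2 x y).some
  exact congrArg Arrow.mk (Subsingleton.elim p p')

theorem IsStrictTerminal.isIsofibration {T : C} (hT : IsStrictTerminal T) {X : C} (f : X ⟶ T) :
    IsIsofibration f :=
  fun _ x _ _ _ => ⟨x, 𝟙 x, inferInstance, hT.arrow_eq _ _⟩

theorem IsPita.nonempty_strictProd (hC : IsPita C) (X Y : C) : Nonempty (StrictProd X Y) := by
  obtain ⟨T, hT⟩ := hC.terminal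
  obtain ⟨P, h, k, H⟩ := hC.pullback ((hT X).1.some.default) ((hT Y).1.some.default)
    (hT.isIsofibration _)
  exact ⟨
    { obj := P
      fst := h
      snd := k
      existsUnique_map := fun f g => H.existsUnique_map f g (hT.hom_eq _ _)
      existsUnique_cell := fun u u' α β => H.existsUnique_cell u u' α β (hT.arrow_eq _ _) }⟩

variable [Bicategory.Strict C]

theorem ArrowObj.isIso {X : C} (o : ArrowObj X) {A : C} {p q : A ⟶ o.obj} (θ : p ⟶ q)
    (h₀ : IsIso (θ ▷ o.d₀)) (h₁ : IsIso (θ ▷ o.d₁)) : IsIso θ := by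
  have sq : (p ◁ o.cell) ≫ θ ▷ o.d₁ = θ ▷ o.d₀ ≫ (q ◁ o.cell) := whisker_exchange θ o.cell
  obtain ⟨φ, ⟨hφ₀, hφ₁⟩, -⟩ := o.existsUnique_cell q p (inv (θ ▷ o.d₀)) (inv (θ ▷ o.d₁)) (by
    rw [IsIso.comp_inv_eq, Category.assoc, IsIso.eq_inv_comp, sq])
  refine ⟨φ, ?_, ?_⟩
  · refine (o.existsUnique_cell p p (𝟙 _) (𝟙 _) (by simp)).unique ?_ (by simp)
    simp [hφ₀, hφ₁]
  · refine (o.existsUnique_cell q q (𝟙 _) (𝟙 _) (by simp)).unique ?_ (by simp)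
    simp [hφ₀, hφ₁]

theorem TriangleObj.isIso {X : C} (o : TriangleObj X) {A : C} {p q : A ⟶ o.obj} (θ : p ⟶ q)
    (h₀ : IsIso (θ ▷ o.d₀)) (h₁ : IsIso (θ ▷ o.d₁)) (h₂ : IsIso (θ ▷ o.d₂)) : IsIso θ := by
  have sq := whisker_exchange θ o.cell₀₁
  have sq' := whisker_exchange θ o.cell₁₂
  obtain ⟨φ, ⟨hφ₀, hφ₁, hφ₂⟩, -⟩ := o.existsUnique_cell q p (inv (θ ▷ o.d₀)) (inv (θ ▷ o.d₁))
    (inv (θ ▷ o.d₂)) (by rw [IsIso.comp_inv_eq, Category.assoc, IsIso.eq_inv_comp, sq])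
    (by rw [IsIso.comp_inv_eq, Category.assoc, IsIso.eq_inv_comp, sq'])
  refine ⟨φ, ?_, ?_⟩
  · refine (o.existsUnique_cell p p (𝟙 _) (𝟙 _) (𝟙 _) (by simp) (by simp)).unique ?_ (by simp)
    simp [hφ₀, hφ₁, hφ₂]
  · refine (o.existsUnique_cell q q (𝟙 _) (𝟙 _) (𝟙 _) (by simp) (by simp)).unique ?_ (by simp)
    simp [hφ₀, hφ₁, hφ₂]

/-- An invertible 2-cell `x d₁ ⟶ b` lifts to the 2-cell from `x` to its composite with `x ∂`, which
is an identity on domains. -/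
theorem ArrowObj.isIsofibration_d₁ {X : C} (o : ArrowObj X) : IsIsofibration o.d₁ := by
  refine isIsofibration_of_lift fun {A} x b β hβ => ?_
  obtain ⟨y, hy, -⟩ := o.existsUnique_map (x ◁ o.cell ≫ β)
  have hl : y ≫ o.d₀ = x ≫ o.d₀ := congrArg Arrow.left hy
  obtain rfl : y ≫ o.d₁ = b := congrArg Arrow.right hy
  obtain ⟨θ, ⟨h₀, h₁⟩, -⟩ := o.existsUnique_cell x y (eqToHom hl.symm) β (by
    refine Arrow.mk_injective _ _ ?_
    rw [Arrow.arrow_mk_eqToHom_comp, hy])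
  exact ⟨y, θ, o.isIso θ (h₀ ▸ inferInstance) (h₁ ▸ hβ), congrArg Arrow.mk h₁⟩

/-- The cotensor of `X` with `{0 < 1 < 2}` is the object of composable pairs of 2-cells, i.e. the
pullback of `X^→` with itself over `X`. -/
theorem IsPita.nonempty_triangleObj (hC : IsPita C) (X : C) : Nonempty (TriangleObj X) := by
  obtain ⟨o⟩ := hC.arrow X
  obtain ⟨P, h, k, H⟩ := hC.pullback o.d₁ o.d₀ o.isIsofibration_d₁
  have key : ∀ {A : C} (u : A ⟶ P), Arrow.mk (u ◁ (eqToHom H.w ≫ k ◁ o.cell)) =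
      Arrow.mk ((u ≫ k) ◁ o.cell) := by
    intro A u
    rw [mk_wL, Arrow.arrow_mk_eqToHom_comp, mk_wL, ← wL_comp]; rfl
  have key' : ∀ {A : C} (u : A ⟶ P), Arrow.mk (u ◁ (h ◁ o.cell)) =
      Arrow.mk ((u ≫ h) ◁ o.cell) := by
    intro A u
    rw [mk_wL, mk_wL, ← wL_comp]; rfl
  refine ⟨
    { obj := P
      d₀ := h ≫ o.d₀
      d₁ := h ≫ o.d₁
      d₂ := k ≫ o.d₁
      cell₀₁ := h ◁ o.cell
      cell₁₂ := eqToHom H.w ≫ k ◁ o.cell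
      existsUnique_map := ?_
      existsUnique_cell := ?_ }⟩
  · intro A f g l α β
    obtain ⟨u, ⟨hu, hu'⟩, huu⟩ := H.existsUnique_map (o.lift α) (o.lift β) (by simp)
    refine ⟨u, ⟨?_, ?_⟩, ?_⟩
    · rw [key', hu, o.lift_spec]
    · rw [key, hu', o.lift_spec]
    · rintro v ⟨hv, hv'⟩
      rw [key'] at hv
      rw [key] at hv'
      refine huu v ⟨o.hom_ext ?_, o.hom_ext ?_⟩
      · exact hv.trans (o.lift_spec α).symm
      · exact hv'.trans (o.lift_spec β).symm
  · intro A u u' a₀ a₁ a₂ h₀ h₁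
    obtain ⟨θ, hθ₀, hθ₁⟩ := o.exists_arrow (u ≫ h) (u' ≫ h) (Arrow.mk a₀) (Arrow.mk a₁)
      (Strict.assoc _ _ _).symm (Strict.assoc _ _ _).symm (Strict.assoc _ _ _).symm
      (Strict.assoc _ _ _).symm (by
        have e := (acomp_mk _ _).trans ((congrArg Arrow.mk h₀).trans (acomp_mk _ _).symm)
        exact (acomp_congr _ (key' u) rfl).symm.trans (e.trans (acomp_congr _ rfl (key' u'))))
    have e₁ : ∀ v : A ⟶ P, v ≫ h ≫ o.d₁ = (v ≫ k) ≫ o.d₀ := fun v => by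
      rw [H.w, Strict.assoc]
    obtain ⟨φ, hφ₀, hφ₁⟩ := o.exists_arrow (u ≫ k) (u' ≫ k) (Arrow.mk a₁) (Arrow.mk a₂)
      (e₁ u) (e₁ u') (Strict.assoc _ _ _).symm (Strict.assoc _ _ _).symm (by
        have e := (acomp_mk _ _).trans ((congrArg Arrow.mk h₁).trans (acomp_mk _ _).symm)
        exact (acomp_congr _ (key u) rfl).symm.trans (e.trans (acomp_congr _ rfl (key u'))))
    obtain ⟨ψ, ⟨hψ, hψ'⟩, -⟩ := H.existsUnique_cell u u' θ φ (hθ₁.trans hφ₀.symm)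
    subst hψ hψ'
    have c : ∀ ψ : u ⟶ u', ∀ {Z Z' : C} (p : P ⟶ Z) (q : Z ⟶ Z'),
        Arrow.mk (ψ ▷ (p ≫ q)) = wR (Arrow.mk (ψ ▷ p)) q :=
      fun ψ _ _ p q => wR_comp (Arrow.mk ψ) p q
    refine ⟨ψ, ⟨Arrow.mk_injective _ _ ?_, Arrow.mk_injective _ _ ?_,
      Arrow.mk_injective _ _ ?_⟩, ?_⟩
    · exact (c ψ _ _).trans hθ₀
    · exact (c ψ _ _).trans hθ₁
    · exact (c ψ _ _).trans hφ₁
    · rintro χ ⟨rfl, rfl, rfl⟩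
      have e : ∀ χ : u ⟶ u', wR (Arrow.mk (χ ▷ h)) o.d₁ = wR (Arrow.mk (χ ▷ k)) o.d₀ :=
        fun χ => H.wR_w (Arrow.mk χ)
      refine Arrow.mk_injective _ _ (H.arrow_ext (o.arrow_ext rfl rfl ?_ ?_)
        (o.arrow_ext rfl rfl ?_ ?_))
      · exact (c χ _ _).symm.trans hθ₀.symm
      · exact (c χ _ _).symm.trans hθ₁.symm
      · exact (e χ).symm.trans ((c χ _ _).symm.trans hφ₀.symm)
      · exact (c χ _ _).symm.trans hφ₁.symm

theorem IsGroupoidant.nonempty_nerveSpec (hC : IsGroupoidant C) (X : C) :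
    Nonempty (NerveSpec X) := by
  obtain ⟨a⟩ := hC.pita.arrow X
  obtain ⟨t⟩ := hC.pita.nonempty_triangleObj X
  exact ⟨⟨a, t, (hC.cores _).some, (hC.cores _).some, (hC.cores _).some⟩⟩

end Limits

/-! ### Nerves are groupoidal congruences -/

namespace NerveSpec

variable {C : Type u} [Bicategory.{w, v} C] [Bicategory.Strict C] {X : C} (s : NerveSpec X)

theorem π₀_eq_of_cell {A : C} {x : A ⟶ s.core₁.obj} {p : A ⟶ s.core₀.obj}
    (h : (s.cell x).left = p ≫ s.core₀.ι) : x ≫ s.π₀ = p :=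
  s.core₀.hom_ext ((s.cell_left x).symm.trans h)

theorem π₁_eq_of_cell {A : C} {x : A ⟶ s.core₁.obj} {p : A ⟶ s.core₀.obj}
    (h : (s.cell x).right = p ≫ s.core₀.ι) : x ≫ s.π₁ = p :=
  s.core₀.hom_ext ((s.cell_right x).symm.trans h)

theorem wR_π₀_ι {A : C} (a : Arrow (A ⟶ s.core₁.obj)) :
    wR (wR a s.π₀) s.core₀.ι = wR (wR a s.core₁.ι) s.arr.d₀ := by
  rw [← wR_comp, ← wR_comp, π₀_ι]

theorem wR_π₁_ι {A : C} (a : Arrow (A ⟶ s.core₁.obj)) :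
    wR (wR a s.π₁) s.core₀.ι = wR (wR a s.core₁.ι) s.arr.d₁ := by
  rw [← wR_comp, ← wR_comp, π₁_ι]

/-- A 2-cell into `(X^→)^≅` is a commuting square of 2-cells into `X`. -/
theorem cell_naturality {A : C} (a : Arrow (A ⟶ s.core₁.obj)) :
    acomp (s.cell a.left) (wR (wR a s.π₁) s.core₀.ι) (s.cell_right _) =
      acomp (wR (wR a s.π₀) s.core₀.ι) (s.cell a.right) (s.cell_left _).symm := by
  have e := exchange a (Arrow.mk s.tautologicalCell)
  exact (acomp_congr _ (s.wL_tautologicalCell _).symm (wR_comp a s.π₁ s.core₀.ι).symm).trans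
    (e.trans (acomp_congr _ (wR_comp a s.π₀ s.core₀.ι) (s.wL_tautologicalCell _)))

/-- A 2-cell into `(X^→)^≅` is determined by its domain and its two components. -/
theorem arrow_ext₁ {A : C} {a b : Arrow (A ⟶ s.core₁.obj)} (hl : a.left = b.left)
    (h₀ : wR a s.π₀ = wR b s.π₀) (h₁ : wR a s.π₁ = wR b s.π₁) : a = b := by
  have hr : a.right = b.right := by
    apply s.cell_ext
    refine acomp_left_cancel (a := wR (wR a s.π₀) s.core₀.ι)
      (isIso_wR_hom _ (s.core₀.isGroupoidal _) _) (h := (s.cell_left _).symm)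
      (k := (congrArg (fun c => (wR c s.core₀.ι).right) h₀).trans (s.cell_left _).symm) ?_
    refine (s.cell_naturality a).symm.trans ?_
    refine Eq.trans ?_ (acomp_congr (s.cell_left b.right).symm
      (congrArg (fun c => wR c s.core₀.ι) h₀.symm) rfl)
    refine Eq.trans ?_ (s.cell_naturality b)
    exact acomp_congr _ (congrArg s.cell hl) (congrArg (fun c => wR c s.core₀.ι) h₁)
  apply s.core₁.arrow_ext
  apply s.arr.arrow_ext
  · exact congrArg (fun x => x ≫ s.core₁.ι) hl
  · exact congrArg (fun x => x ≫ s.core₁.ι) hr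
  · rw [← wR_π₀_ι, ← wR_π₀_ι, h₀]
  · rw [← wR_π₁_ι, ← wR_π₁_ι, h₁]

/-- Every commuting square of 2-cells into `X` whose sides come from `X^≅` is a 2-cell into
`(X^→)^≅`. -/
theorem exists_hom₁ {A : C} (x y : A ⟶ s.core₁.obj) (a₀ a₁ : Arrow (A ⟶ s.core₀.obj))
    (l₀ : a₀.left = x ≫ s.π₀) (r₀ : a₀.right = y ≫ s.π₀)
    (l₁ : a₁.left = x ≫ s.π₁) (r₁ : a₁.right = y ≫ s.π₁)
    (h : acomp (s.cell x) (wR a₁ s.core₀.ι) (by rw [cell_right, wR_left, l₁]) =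
      acomp (wR a₀ s.core₀.ι) (s.cell y) (by rw [cell_left, wR_right, r₀])) :
    ∃ θ : x ⟶ y, wR (Arrow.mk θ) s.π₀ = a₀ ∧ wR (Arrow.mk θ) s.π₁ = a₁ := by
  have e₀ : ∀ z : A ⟶ s.core₁.obj, (z ≫ s.π₀) ≫ s.core₀.ι = (z ≫ s.core₁.ι) ≫ s.arr.d₀ :=
    fun z => (s.cell_left z).symm
  have e₁ : ∀ z : A ⟶ s.core₁.obj, (z ≫ s.π₁) ≫ s.core₀.ι = (z ≫ s.core₁.ι) ≫ s.arr.d₁ :=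
    fun z => (s.cell_right z).symm
  obtain ⟨θ, hθ₀, hθ₁⟩ := s.arr.exists_arrow (x ≫ s.core₁.ι) (y ≫ s.core₁.ι)
    (wR a₀ s.core₀.ι) (wR a₁ s.core₀.ι) (by rw [wR_left, l₀, e₀]) (by rw [wR_right, r₀, e₀])
    (by rw [wR_left, l₁, e₁]) (by rw [wR_right, r₁, e₁]) h
  have hi : IsIso θ := s.arr.isIso θ
    (isIso_of_arrow_mk_eq hθ₀ (isIso_wR_hom _ (s.core₀.isGroupoidal _) _))
    (isIso_of_arrow_mk_eq hθ₁ (isIso_wR_hom _ (s.core₀.isGroupoidal _) _))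
  obtain ⟨φ, hφ, -⟩ := s.core₁.existsUnique_cell x y θ hi
  have hφ' : wR (Arrow.mk φ) s.core₁.ι = Arrow.mk θ := congrArg Arrow.mk hφ
  refine ⟨φ, s.core₀.arrow_ext ?_, s.core₀.arrow_ext ?_⟩
  · rw [wR_π₀_ι, hφ', hθ₀]
  · rw [wR_π₁_ι, hφ', hθ₁]

/-- 2-cells in `X^≅` transport a 2-cell into `X` along its two ends. -/
theorem exists_arrow₁ {A : C} (x : A ⟶ s.core₁.obj) (a₀ a₁ : Arrow (A ⟶ s.core₀.obj))
    (l₀ : a₀.left = x ≫ s.π₀) (l₁ : a₁.left = x ≫ s.π₁) :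
    ∃ a : Arrow (A ⟶ s.core₁.obj), a.left = x ∧ wR a s.π₀ = a₀ ∧ wR a s.π₁ = a₁ := by
  have i₀ : IsIso (wR a₀ s.core₀.ι).hom := isIso_wR_hom _ (s.core₀.isGroupoidal _) _
  have k₀ : (wR a₀ s.core₀.ι).left = (s.cell x).left := by rw [cell_left, wR_left, l₀]
  have k₁ : (s.cell x).right = (wR a₁ s.core₀.ι).left := by rw [cell_right, wR_left, l₁]
  -- The codomain of the transport classifies the conjugate of the 2-cell of `x`.
  let c := acomp (Arrow.mk (inv (wR a₀ s.core₀.ι).hom))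
    (acomp (s.cell x) (wR a₁ s.core₀.ι) k₁) k₀
  let y := s.lift₁ c.hom (s.core₀.isArrowwiseIso.precomp a₀.right)
    (s.core₀.isArrowwiseIso.precomp a₁.right)
  have hy : s.cell y = c := s.cell_lift₁ _ _ _
  have r₀ : y ≫ s.π₀ = a₀.right := s.π₀_eq_of_cell (congrArg Arrow.left hy)
  have r₁ : y ≫ s.π₁ = a₁.right := s.π₁_eq_of_cell (congrArg Arrow.right hy)
  obtain ⟨θ, h₀, h₁⟩ := s.exists_hom₁ x y a₀ a₁ l₀ r₀.symm l₁ r₁.symm (by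
    refine Eq.trans ?_ (acomp_congr (a := wR a₀ s.core₀.ι) (b := c) rfl rfl hy.symm)
    exact (acomp_inv_acomp (wR a₀ s.core₀.ι) (acomp (s.cell x) (wR a₁ s.core₀.ι) k₁) k₀).symm)
  exact ⟨Arrow.mk θ, rfl, h₀, h₁⟩

/-- The unique lift of a 2-cell in `X^≅ × X^≅` with a given domain is transport along its two
components, which are invertible. -/
theorem isDOF_pair (P : StrictProd s.core₀.obj s.core₀.obj) : IsDOF (P.pair s.π₀ s.π₁) := by
  intro A x b f
  obtain ⟨a, ha, h₀, h₁⟩ := s.exists_arrow₁ x (wR (Arrow.mk f) P.fst) (wR (Arrow.mk f) P.snd)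
    ((Strict.assoc _ _ _).trans (congrArg (fun z => x ≫ z) (P.pair_fst _ _)))
    ((Strict.assoc _ _ _).trans (congrArg (fun z => x ≫ z) (P.pair_snd _ _)))
  obtain ⟨x', y, p, rfl⟩ := Arrow.mk_surjective a
  obtain rfl : x' = x := ha
  refine ⟨⟨y, p⟩, ?_, ?_⟩
  · refine P.arrow_ext ?_ ?_
    · exact (P.wR_pair_fst (Arrow.mk p) _ _).trans h₀
    · exact (P.wR_pair_snd (Arrow.mk p) _ _).trans h₁
  · rintro ⟨y', p'⟩ hp'
    refine sigma_eq_of_arrow_mk_eq (s.arrow_ext₁ rfl ?_ ?_)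
    · refine Eq.trans ?_ h₀.symm
      exact (P.wR_pair_fst (Arrow.mk p') _ _).symm.trans (congrArg (fun c => wR c P.fst) hp')
    · refine Eq.trans ?_ h₁.symm
      exact (P.wR_pair_snd (Arrow.mk p') _ _).symm.trans (congrArg (fun c => wR c P.snd) hp')

theorem isIsofibration_pair (P : StrictProd s.core₀.obj s.core₀.obj) :
    IsIsofibration (P.pair s.π₀ s.π₁) := by
  intro A x b f _
  obtain ⟨⟨y, p⟩, hp, -⟩ := s.isDOF_pair P A x b f
  exact ⟨y, p, s.core₁.isGroupoidal p, hp⟩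

theorem isIsofibration_π₁ : IsIsofibration s.π₁ := by
  refine isIsofibration_of_lift fun {A} x b f _ => ?_
  obtain ⟨a, ha, -, h₁⟩ := s.exists_arrow₁ x (Arrow.mk (𝟙 (x ≫ s.π₀))) (Arrow.mk f) rfl rfl
  obtain ⟨x', y, p, rfl⟩ := Arrow.mk_surjective a
  obtain rfl : x' = x := ha
  exact ⟨y, p, s.core₁.isGroupoidal p, h₁⟩

theorem isGboCongruence (P : StrictProd s.core₀.obj s.core₀.obj) : IsGboCongruence s.nerve where
  isInternalDoubleCat := ⟨P, s.isIsofibration_pair P⟩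
  groupoidal₀ := s.core₀.isGroupoidal
  groupoidal₁ := s.core₁.isGroupoidal
  groupoidal₂ := s.core₂.isGroupoidal
  isDOF := ⟨P, s.isDOF_pair P⟩

theorem wR_π₀₁_π₀_ι {A : C} (a : Arrow (A ⟶ s.core₂.obj)) :
    wR (wR (wR a s.π₀₁) s.π₀) s.core₀.ι = wR (wR a s.core₂.ι) s.tri.d₀ := by
  have h := congrArg Arrow.left (s.cell_π₀₁ (𝟙 _))
  rw [cell_left] at h
  simp only [Strict.id_comp, Strict.assoc] at h
  rw [← wR_comp, ← wR_comp, h, ← wR_comp]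
  rfl

theorem wR_π₀₁_π₁_ι {A : C} (a : Arrow (A ⟶ s.core₂.obj)) :
    wR (wR (wR a s.π₀₁) s.π₁) s.core₀.ι = wR (wR a s.core₂.ι) s.tri.d₁ := by
  have h := congrArg Arrow.right (s.cell_π₀₁ (𝟙 _))
  rw [cell_right] at h
  simp only [Strict.id_comp, Strict.assoc] at h
  rw [← wR_comp, ← wR_comp, h, ← wR_comp]
  rfl

theorem wR_π₁₂_π₁_ι {A : C} (a : Arrow (A ⟶ s.core₂.obj)) :
    wR (wR (wR a s.π₁₂) s.π₁) s.core₀.ι = wR (wR a s.core₂.ι) s.tri.d₂ := by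
  have h := congrArg Arrow.right (s.cell_π₁₂ (𝟙 _))
  rw [cell_right] at h
  simp only [Strict.id_comp, Strict.assoc] at h
  rw [← wR_comp, ← wR_comp, h, ← wR_comp]
  rfl

/-- The square defining the object of composable pairs in the nerve is a pullback also for
2-cells. -/
theorem isStrictPullback : IsStrictPullback s.π₀₁ s.π₁₂ s.π₁ s.π₀ := by
  refine .of_arrow s.nerve_isPullback.w (fun x y h => s.existsUnique_comp x y h) ?_ ?_
  · intro B a b hl hr h₁ h₂
    apply s.core₂.arrow_ext
    apply s.tri.arrow_ext
    · exact congrArg (fun x => x ≫ s.core₂.ι) hl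
    · exact congrArg (fun x => x ≫ s.core₂.ι) hr
    · rw [← wR_π₀₁_π₀_ι, ← wR_π₀₁_π₀_ι, h₁]
    · rw [← wR_π₀₁_π₁_ι, ← wR_π₀₁_π₁_ι, h₁]
    · rw [← wR_π₁₂_π₁_ι, ← wR_π₁₂_π₁_ι, h₂]
  · intro B u u' a b l₁ r₁ l₂ r₂ h
    have d₀ : ∀ z : B ⟶ s.core₂.obj,
        ((z ≫ s.π₀₁) ≫ s.π₀) ≫ s.core₀.ι = (z ≫ s.core₂.ι) ≫ s.tri.d₀ := fun z =>
      congrArg Arrow.left (s.wR_π₀₁_π₀_ι (Arrow.mk (𝟙 z)))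
    have d₁ : ∀ z : B ⟶ s.core₂.obj,
        ((z ≫ s.π₀₁) ≫ s.π₁) ≫ s.core₀.ι = (z ≫ s.core₂.ι) ≫ s.tri.d₁ := fun z =>
      congrArg Arrow.left (s.wR_π₀₁_π₁_ι (Arrow.mk (𝟙 z)))
    have d₂ : ∀ z : B ⟶ s.core₂.obj,
        ((z ≫ s.π₁₂) ≫ s.π₁) ≫ s.core₀.ι = (z ≫ s.core₂.ι) ≫ s.tri.d₂ := fun z =>
      congrArg Arrow.left (s.wR_π₁₂_π₁_ι (Arrow.mk (𝟙 z)))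
    have n₁ := s.cell_naturality a
    have n₂ := s.cell_naturality b
    have h' : wR (wR b s.π₀) s.core₀.ι = wR (wR a s.π₁) s.core₀.ι := by rw [h]
    obtain ⟨θ, hθ₀, hθ₁, hθ₂⟩ := s.tri.exists_arrow (u ≫ s.core₂.ι) (u' ≫ s.core₂.ι)
      (wR (wR a s.π₀) s.core₀.ι) (wR (wR a s.π₁) s.core₀.ι) (wR (wR b s.π₁) s.core₀.ι)
      (by rw [wR_left, wR_left, l₁, d₀]) (by rw [wR_right, wR_right, r₁, d₀])
      (by rw [wR_left, wR_left, l₁, d₁]) (by rw [wR_right, wR_right, r₁, d₁])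
      (by rw [wR_left, wR_left, l₂, d₂]) (by rw [wR_right, wR_right, r₂, d₂])
      (by
        refine Eq.trans ?_ (n₁.trans ?_)
        · exact acomp_congr _ ((s.cell_π₀₁ u).symm.trans (congrArg s.cell l₁.symm)) rfl
        · exact acomp_congr _ rfl ((congrArg s.cell r₁).trans (s.cell_π₀₁ u')))
      (by
        refine Eq.trans ?_ (n₂.trans ?_)
        · exact acomp_congr _ ((s.cell_π₁₂ u).symm.trans (congrArg s.cell l₂.symm)) rfl
        · exact acomp_congr _ h' ((congrArg s.cell r₂).trans (s.cell_π₁₂ u')))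
    have hi : IsIso θ := s.tri.isIso θ
      (isIso_of_arrow_mk_eq hθ₀ (isIso_wR_hom _ (s.core₀.isGroupoidal _) _))
      (isIso_of_arrow_mk_eq hθ₁ (isIso_wR_hom _ (s.core₀.isGroupoidal _) _))
      (isIso_of_arrow_mk_eq hθ₂ (isIso_wR_hom _ (s.core₀.isGroupoidal _) _))
    obtain ⟨φ, hφ, -⟩ := s.core₂.existsUnique_cell u u' θ hi
    have hφ' : wR (Arrow.mk φ) s.core₂.ι = Arrow.mk θ := congrArg Arrow.mk hφ
    have e₁ : wR (wR (Arrow.mk φ) s.π₀₁) s.π₁ = wR a s.π₁ :=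
      s.core₀.arrow_ext (by rw [wR_π₀₁_π₁_ι, hφ', hθ₁])
    refine ⟨φ, s.arrow_ext₁ l₁.symm (s.core₀.arrow_ext ?_) e₁,
      s.arrow_ext₁ l₂.symm ?_ (s.core₀.arrow_ext ?_)⟩
    · rw [wR_π₀₁_π₀_ι, hφ', hθ₀]
    · rw [← h, ← e₁, ← wR_comp, ← wR_comp]
      exact congrArg _ s.nerve_isPullback.w.symm
    · rw [wR_π₁₂_π₁_ι, hφ', hθ₂]

end NerveSpec

/-! ### Nerves are Rezk complete -/

namespace NerveSpec

variable {C : Type u} [Bicategory.{w, v} C] [Bicategory.Strict C] {X : C} (s : NerveSpec X)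

/-- The morphism `A ⟶ (X^→)^≅` classifying the image in `X` of a 2-cell in `X^≅`. -/
noncomputable def ofCore {A : C} {f g : A ⟶ s.core₀.obj} (α : f ⟶ g) : A ⟶ s.core₁.obj :=
  s.lift₁ (α ▷ s.core₀.ι) (s.core₀.isArrowwiseIso.precomp f) (s.core₀.isArrowwiseIso.precomp g)

theorem cell_comp_ofCore {A B : C} {f g : A ⟶ s.core₀.obj} (α : f ⟶ g) (m : B ⟶ A) :
    s.cell (m ≫ s.ofCore α) = wR (wL m (Arrow.mk α)) s.core₀.ι := by
  rw [cell_comp, ofCore, cell_lift₁, mk_wR, wL_wR]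

theorem cell_ofCore {A : C} {f g : A ⟶ s.core₀.obj} (α : f ⟶ g) :
    s.cell (s.ofCore α) = wR (Arrow.mk α) s.core₀.ι :=
  s.cell_lift₁ _ _ _

theorem ofCore_π₀ {A : C} {f g : A ⟶ s.core₀.obj} (α : f ⟶ g) : s.ofCore α ≫ s.π₀ = f :=
  s.π₀_eq_of_cell (congrArg Arrow.left (s.cell_ofCore α))

theorem ofCore_π₁ {A : C} {f g : A ⟶ s.core₀.obj} (α : f ⟶ g) : s.ofCore α ≫ s.π₁ = g :=
  s.π₁_eq_of_cell (congrArg Arrow.right (s.cell_ofCore α))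

theorem acomp_cell_ofCore {A B : C} {f g : A ⟶ s.core₀.obj} {α : f ⟶ g} {β : g ⟶ f}
    (e : α ≫ β = 𝟙 f) (m : B ⟶ A)
    (k : (s.cell (m ≫ s.ofCore α)).right = (s.cell (m ≫ s.ofCore β)).left) :
    acomp (s.cell (m ≫ s.ofCore α)) (s.cell (m ≫ s.ofCore β)) k =
      Arrow.mk (𝟙 ((m ≫ f) ≫ s.core₀.ι)) := by
  refine (acomp_congr _ (s.cell_comp_ofCore _ _) (s.cell_comp_ofCore _ _)).trans ?_
  refine (wR_acomp (wL m (Arrow.mk α)) (wL m (Arrow.mk β)) rfl _).symm.trans ?_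
  rw [← wR_mk_id, ← wL_mk_id, ← e, ← acomp_mk, wL_acomp]

theorem comp_ofCore_injective {A : C} (o : ArrowObj s.core₀.obj) {m m' : A ⟶ o.obj}
    (h : m ≫ s.ofCore o.cell = m' ≫ s.ofCore o.cell) : m = m' := by
  apply o.hom_ext
  apply s.core₀.arrow_ext
  rw [← cell_comp_ofCore, ← cell_comp_ofCore, h]

theorem comp_π₀₂ {A : C} (z : A ⟶ s.core₂.obj) :
    z ≫ s.π₀₂ = s.nerve.mul (z ≫ s.π₀₁) (z ≫ s.π₁₂) (s.comp_π₀_π₁ z) :=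
  s.cell_ext ((s.cell_π₀₂ z).trans (s.cell_mul _ _ _).symm)

theorem isReflection (o : ArrowObj s.core₀.obj) :
    IsReflection s.nerve o (s.ofCore o.cell) := by
  have hid : s.cell (o.d₁ ≫ s.e) = Arrow.mk (𝟙 (o.d₁ ≫ s.core₀.ι)) := s.cell_e o.d₁
  obtain ⟨ρ, h₀, h₁⟩ := s.exists_hom₁ (s.ofCore o.cell) (o.d₁ ≫ s.e) (Arrow.mk o.cell)
    (Arrow.mk (𝟙 o.d₁)) (s.ofCore_π₀ _).symm
    (s.π₀_eq_of_cell (congrArg Arrow.left hid)).symm (s.ofCore_π₁ _).symm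
    (s.π₁_eq_of_cell (congrArg Arrow.right hid)).symm (by
      refine (acomp_congr _ (s.cell_ofCore _) (wR_mk_id _ _)).trans ?_
      refine Eq.trans ?_ (acomp_congr _ rfl hid).symm
      refine (acomp_id _ _ rfl).trans (acomp_id _ _ rfl).symm)
  exact ⟨ρ, h₀, h₁⟩

/-- A composable triple `(u, v, w)` in the nerve with `uv` and `vw` identities consists of an
invertible 2-cell `u`, its inverse `v` and `w = u`; it thus comes from a 2-cell in `X^≅`. -/
theorem exists_ofCore_of_mul_eq_e {A : C} (o : ArrowObj s.core₀.obj) [IsIso o.cell]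
    (x y z : A ⟶ s.core₁.obj) (hxy : x ≫ s.π₁ = y ≫ s.π₀) (hyz : y ≫ s.π₁ = z ≫ s.π₀)
    {p q : A ⟶ s.core₀.obj} (h : s.nerve.mul x y hxy = p ≫ s.e)
    (h' : s.nerve.mul y z hyz = q ≫ s.e) :
    ∃ m : A ⟶ o.obj, m ≫ s.ofCore o.cell = x ∧ m ≫ s.ofCore (inv o.cell) = y ∧
      m ≫ s.ofCore o.cell = z := by
  have e := (s.cell_mul x y hxy).symm.trans ((congrArg s.cell h).trans (s.cell_e p))
  have e' := (s.cell_mul y z hyz).symm.trans ((congrArg s.cell h').trans (s.cell_e q))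
  obtain ⟨hxz, hi⟩ := eq_and_isIso_of_acomp_eq_id e e'
  obtain rfl := s.cell_ext hxz
  obtain ⟨a, ha⟩ := s.core₀.exists_arrow (s.cell x) hi (s.isArrowwiseIso_left x)
    (s.isArrowwiseIso_right x)
  obtain ⟨m, hm, -⟩ := o.existsUnique_map a.hom
  have hm' : wL m (Arrow.mk o.cell) = a := hm
  have hx : s.cell (m ≫ s.ofCore o.cell) = s.cell x := by rw [cell_comp_ofCore, hm', ha]
  refine ⟨m, s.cell_ext hx, s.cell_ext ?_, s.cell_ext hx⟩
  have k : (s.cell (m ≫ s.ofCore o.cell)).right = (s.cell (m ≫ s.ofCore (inv o.cell))).left := by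
    rw [cell_comp_ofCore, cell_comp_ofCore]; rfl
  have k' : (s.cell x).right = (s.cell (m ≫ s.ofCore (inv o.cell))).left := by rw [← hx, k]
  -- The 2-cells of `y` and of `m ≫ ofCore (inv o.cell)` are both right inverse to that of `x`.
  refine acomp_left_cancel hi (h := k') (k := s.cell_composable hxy) ?_
  refine ((acomp_congr k' hx.symm rfl).trans
    (s.acomp_cell_ofCore (IsIso.hom_inv_id o.cell) m k)).trans (Eq.trans ?_ e.symm)
  have hl := congrArg Arrow.left e
  have hl' := (congrArg Arrow.left hx).symm.trans 
    (congrArg Arrow.left (s.cell_comp_ofCore o.cell m))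
  have : (m ≫ o.d₀) ≫ s.core₀.ι = p ≫ s.core₀.ι := hl'.symm.trans hl
  rw [this]

/-- A morphism into the pullback in the completeness square is a composable triple `(u, v, w)` of
2-cells into `X` with `uv` and `vw` identities, i.e. a 2-cell in `X^≅`; a 2-cell into the pullback
is determined by its values at the four vertices of the triple, and there it takes the values of the
given 2-cell into `X^≅ × X^≅`, alternating between its two components. -/
theorem isRezkComplete (hC : IsPita C) : IsRezkComplete s.nerve := by
  obtain ⟨o⟩ := hC.arrow s.core₀.obj
  obtain ⟨P⟩ := hC.nonempty_strictProd s.core₀.obj s.core₀.obj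
  obtain ⟨Q⟩ := hC.nonempty_strictProd s.core₁.obj s.core₁.obj
  obtain ⟨C₃, π₀₁₂, π₁₂₃, H⟩ := hC.pullback s.π₁₂ s.π₀₁
    (s.isStrictPullback.isIsofibration_snd s.isIsofibration_π₁)
  have hi : IsIso o.cell := s.core₀.isGroupoidal o.cell
  let r := s.ofCore o.cell
  let τ := o.lift (inv o.cell)
  have hτ : wL τ (Arrow.mk o.cell) = Arrow.mk (inv o.cell) := o.lift_spec _
  have hτr : τ ≫ r = s.ofCore (inv o.cell) := by
    apply s.cell_ext
    rw [cell_comp_ofCore, hτ, cell_ofCore]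
  have r₀ : r ≫ s.π₀ = o.d₀ := s.ofCore_π₀ _
  have r₁ : r ≫ s.π₁ = o.d₁ := s.ofCore_π₁ _
  have τr₀ : (τ ≫ r) ≫ s.π₀ = o.d₁ := by rw [hτr, ofCore_π₀]
  have τr₁ : (τ ≫ r) ≫ s.π₁ = o.d₀ := by rw [hτr, ofCore_π₁]
  obtain ⟨z₁, ⟨hz₁, hz₁'⟩, -⟩ := s.existsUnique_comp r (τ ≫ r) (r₁.trans τr₀.symm)
  obtain ⟨z₂, ⟨hz₂, hz₂'⟩, -⟩ := s.existsUnique_comp (τ ≫ r) r (τr₁.trans r₀.symm)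
  obtain ⟨t, ⟨ht, ht'⟩, -⟩ := H.existsUnique_map z₁ z₂ (hz₁'.trans hz₂.symm)
  have t₁ : t ≫ π₀₁₂ ≫ s.π₀₁ = r := by rw [← Strict.assoc, ht, hz₁]
  have t₂ : t ≫ π₀₁₂ ≫ s.π₁₂ = τ ≫ r := by rw [← Strict.assoc, ht, hz₁']
  have t₃ : t ≫ π₁₂₃ ≫ s.π₁₂ = r := by rw [← Strict.assoc, ht', hz₂']
  suffices main : IsStrictPullback t (P.pair o.d₀ o.d₁)
      (Q.pair (π₀₁₂ ≫ s.π₀₂) (π₁₂₃ ≫ s.π₀₂)) (Q.pair (P.fst ≫ s.e) (P.snd ≫ s.e)) from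
    ⟨o, r, τ, P, Q, C₃, π₀₁₂, π₁₂₃, t, s.isReflection o, ⟨hi, hτ⟩, H, t₁, t₂, t₃, main⟩
  have p₀ : s.π₀₂ ≫ s.π₀ = s.π₀₁ ≫ s.π₀ := s.nerve.π₀₂_π₀
  have p₁ : s.π₀₂ ≫ s.π₁ = s.π₁₂ ≫ s.π₁ := s.nerve.π₀₂_π₁
  have q : s.π₀₁ ≫ s.π₁ = s.π₁₂ ≫ s.π₀ := s.nerve_isPullback.w
  have w₁ : t ≫ π₀₁₂ ≫ s.π₀₂ = o.d₀ ≫ s.e := by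
    have hz : z₁ ≫ s.π₀₂ = o.d₀ ≫ s.e := by
      apply s.cell_ext
      refine (s.cell_π₀₂ z₁).trans ((acomp_congr _ (congrArg s.cell (hz₁.trans
        (Strict.id_comp _).symm)) (congrArg s.cell ((hz₁'.trans hτr).trans
        (Strict.id_comp _).symm))).trans ?_)
      refine (s.acomp_cell_ofCore (IsIso.hom_inv_id o.cell) (𝟙 _) _).trans ?_
      rw [cell_e, Strict.id_comp]
    rw [← Strict.assoc, ht, hz]
  have w₂ : t ≫ π₁₂₃ ≫ s.π₀₂ = o.d₁ ≫ s.e := by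
    have hz : z₂ ≫ s.π₀₂ = o.d₁ ≫ s.e := by
      apply s.cell_ext
      refine (s.cell_π₀₂ z₂).trans ((acomp_congr _ (congrArg s.cell ((hz₂.trans hτr).trans
        (Strict.id_comp _).symm)) (congrArg s.cell (hz₂'.trans
        (Strict.id_comp _).symm))).trans ?_)
      refine (s.acomp_cell_ofCore (IsIso.inv_hom_id o.cell) (𝟙 _) _).trans ?_
      rw [cell_e, Strict.id_comp]
    rw [← Strict.assoc, ht', hz]
  have e₀ : s.e ≫ s.π₀ = 𝟙 _ := s.nerve.e_π₀
  have e₁ : s.e ≫ s.π₁ = 𝟙 _ := s.nerve.e_π₁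
  refine .of_arrow ?_ ?_ ?_ ?_
  · apply Q.hom_ext
    · rw [Strict.assoc, Strict.assoc, Q.pair_fst, Q.pair_fst, ← Strict.assoc _ P.fst, P.pair_fst,
        w₁]
    · rw [Strict.assoc, Strict.assoc, Q.pair_snd, Q.pair_snd, ← Strict.assoc _ P.snd, P.pair_snd,
        w₂]
  · intro B h' k' hk
    have f₁ : (h' ≫ π₀₁₂) ≫ s.π₀₂ = (k' ≫ P.fst) ≫ s.e := by
      have := congrArg (fun x => x ≫ Q.fst) hk
      simpa only [Strict.assoc, Q.pair_fst] using this
    have f₂ : (h' ≫ π₁₂₃) ≫ s.π₀₂ = (k' ≫ P.snd) ≫ s.e := by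
      have := congrArg (fun x => x ≫ Q.snd) hk
      simpa only [Strict.assoc, Q.pair_snd] using this
    have hy : (h' ≫ π₁₂₃) ≫ s.π₀₁ = (h' ≫ π₀₁₂) ≫ s.π₁₂ := (H.comp_w h').symm
    obtain ⟨m, m₁, m₂, m₃⟩ := s.exists_ofCore_of_mul_eq_e o ((h' ≫ π₀₁₂) ≫ s.π₀₁)
      ((h' ≫ π₀₁₂) ≫ s.π₁₂) ((h' ≫ π₁₂₃) ≫ s.π₁₂) (s.comp_π₀_π₁ _)
      (by rw [← hy]; exact s.comp_π₀_π₁ _) ((s.comp_π₀₂ _).symm.trans f₁)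
      ((s.nerve.mul_congr _ hy.symm rfl).trans ((s.comp_π₀₂ _).symm.trans f₂))
    have q₁ : (m ≫ t) ≫ π₀₁₂ = h' ≫ π₀₁₂ := by
      refine s.isStrictPullback.hom_ext ?_ ?_ (s.isStrictPullback.comp_w _)
      · rw [← m₁, Strict.assoc, Strict.assoc, t₁]
      · rw [← m₂, Strict.assoc, Strict.assoc, t₂, hτr]
    have q₂ : (m ≫ t) ≫ π₁₂₃ = h' ≫ π₁₂₃ := by
      refine s.isStrictPullback.hom_ext ?_ ?_ (s.isStrictPullback.comp_w _)
      · rw [hy, ← q₁, H.comp_w]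
      · rw [← m₃, Strict.assoc, Strict.assoc, t₃]
    refine ⟨m, ⟨H.hom_ext q₁ q₂ (H.comp_w _), P.hom_ext ?_ ?_⟩, ?_⟩
    · have := congrArg (fun x => x ≫ s.π₀) f₁
      simp only [Strict.assoc, p₀, e₀, Strict.comp_id] at this
      rw [Strict.assoc, P.pair_fst, ← this, ← r₀, ← Strict.assoc m r, m₁]
      simp only [Strict.assoc]
    · have := congrArg (fun x => x ≫ s.π₁) f₂
      simp only [Strict.assoc, p₁, e₁, Strict.comp_id] at this
      rw [Strict.assoc, P.pair_snd, ← this, ← r₁, ← Strict.assoc m r, m₃]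
      simp only [Strict.assoc]
    · rintro m' ⟨hm', -⟩
      apply s.comp_ofCore_injective o
      rw [m₁, ← hm', Strict.assoc, Strict.assoc, t₁]
  · intro B a b hl hr _ h₂
    apply o.arrow_ext hl hr
    · rw [← P.wR_pair_fst a o.d₀ o.d₁, h₂, P.wR_pair_fst]
    · rw [← P.wR_pair_snd a o.d₀ o.d₁, h₂, P.wR_pair_snd]
  · intro B u u' a b l₁ r₁' l₂ r₂ h
    have f₁ : wR a (π₀₁₂ ≫ s.π₀₂) = wR (wR b P.fst) s.e := by
      rw [← Q.wR_pair_fst a (π₀₁₂ ≫ s.π₀₂) (π₁₂₃ ≫ s.π₀₂), h, Q.wR_pair_fst, wR_comp]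
    have f₂ : wR a (π₁₂₃ ≫ s.π₀₂) = wR (wR b P.snd) s.e := by
      rw [← Q.wR_pair_snd a (π₀₁₂ ≫ s.π₀₂) (π₁₂₃ ≫ s.π₀₂), h, Q.wR_pair_snd, wR_comp]
    -- The four vertices of `a` are those of `b`, in the order `0, 1, 0, 1`.
    have v₀ : wR (wR (wR a π₀₁₂) s.π₀₁) s.π₀ = wR b P.fst := by
      have := congrArg (fun c => wR c s.π₀) f₁
      simpa only [← wR_comp, Strict.assoc, p₀, e₀, Strict.comp_id] using this
    have v₁ : wR (wR (wR a π₀₁₂) s.π₀₁) s.π₁ = wR b P.snd := by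
      have := congrArg (fun c => wR c s.π₀) f₂
      simp only [← wR_comp, Strict.assoc, p₀, e₀, Strict.comp_id] at this
      rw [← this, ← Strict.assoc π₁₂₃, ← H.w, Strict.assoc, ← q]
      simp only [wR_comp]
    have v₂ : wR (wR (wR a π₀₁₂) s.π₁₂) s.π₁ = wR b P.fst := by
      have := congrArg (fun c => wR c s.π₁) f₁
      simpa only [← wR_comp, Strict.assoc, p₁, e₁, Strict.comp_id] using this
    have v₃ : wR (wR (wR a π₁₂₃) s.π₁₂) s.π₁ = wR b P.snd := by
      have := congrArg (fun c => wR c s.π₁) f₂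
      simpa only [← wR_comp, Strict.assoc, p₁, e₁, Strict.comp_id] using this
    have q' : ∀ {c : Arrow (B ⟶ s.core₂.obj)},
        wR (wR c s.π₁₂) s.π₀ = wR (wR c s.π₀₁) s.π₁ := fun {c} =>
      (s.isStrictPullback.wR_w c).symm
    have n := s.cell_naturality (wR (wR a π₀₁₂) s.π₀₁)
    have nl : s.cell (wR (wR a π₀₁₂) s.π₀₁).left = wR (wL u (Arrow.mk o.cell)) s.core₀.ι := by
      rw [wR_left, wR_left, l₁, Strict.assoc, Strict.assoc, t₁, cell_comp_ofCore]
    have nr : s.cell (wR (wR a π₀₁₂) s.π₀₁).right = wR (wL u' (Arrow.mk o.cell)) s.core₀.ι := by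
      rw [wR_right, wR_right, r₁', Strict.assoc, Strict.assoc, t₁, cell_comp_ofCore]
    have b₀l : (wR b P.fst).left = u ≫ o.d₀ := by rw [wR_left, l₂, Strict.assoc, P.pair_fst]
    have b₀r : (wR b P.fst).right = u' ≫ o.d₀ := by rw [wR_right, r₂, Strict.assoc, P.pair_fst]
    have b₁l : (wR b P.snd).left = u ≫ o.d₁ := by rw [wR_left, l₂, Strict.assoc, P.pair_snd]
    have b₁r : (wR b P.snd).right = u' ≫ o.d₁ := by rw [wR_right, r₂, Strict.assoc, P.pair_snd]
    obtain ⟨θ, h₀, h₁⟩ := o.exists_arrow u u' (wR b P.fst) (wR b P.snd) b₀l b₀r b₁l b₁r (by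
      apply s.core₀.arrow_ext
      refine (wR_acomp (wL u (Arrow.mk o.cell)) (wR b P.snd) b₁l.symm _).trans (Eq.trans ?_
        ((n.trans ?_).trans (wR_acomp (wR b P.fst) (wL u' (Arrow.mk o.cell)) b₀r _).symm))
      · exact acomp_congr _ nl.symm (congrArg (fun c => wR c s.core₀.ι) v₁.symm)
      · exact acomp_congr _ (congrArg (fun c => wR c s.core₀.ι) v₀) nr)
    have s₁ : wR (wR (wR (Arrow.mk θ) t) π₀₁₂) s.π₀₁ = wR (wR a π₀₁₂) s.π₀₁ := by
      refine s.arrow_ext₁ (congrArg (fun x => (x ≫ π₀₁₂) ≫ s.π₀₁) l₁.symm) ?_ ?_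
      · rw [v₀, ← wR_comp _ t, ← wR_comp _ (t ≫ _), ← wR_comp, Strict.assoc t, t₁, r₀, h₀]
      · rw [v₁, ← wR_comp _ t, ← wR_comp _ (t ≫ _), ← wR_comp, Strict.assoc t, t₁, r₁, h₁]
    have s₂ : wR (wR (wR (Arrow.mk θ) t) π₀₁₂) s.π₁₂ = wR (wR a π₀₁₂) s.π₁₂ := by
      refine s.arrow_ext₁ (congrArg (fun x => (x ≫ π₀₁₂) ≫ s.π₁₂) l₁.symm) ?_ ?_
      · rw [q', q', s₁]
      · rw [v₂, ← wR_comp _ t, ← wR_comp _ (t ≫ _), ← wR_comp, Strict.assoc t, t₂, τr₁, h₀]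
    have s₃ : wR (wR (wR (Arrow.mk θ) t) π₁₂₃) s.π₀₁ = wR (wR a π₁₂₃) s.π₀₁ := by
      rw [← H.wR_w, ← H.wR_w, s₂]
    have s₄ : wR (wR (wR (Arrow.mk θ) t) π₁₂₃) s.π₁₂ = wR (wR a π₁₂₃) s.π₁₂ := by
      refine s.arrow_ext₁ (congrArg (fun x => (x ≫ π₁₂₃) ≫ s.π₁₂) l₁.symm) ?_ ?_
      · rw [q', q', s₃]
      · rw [v₃, ← wR_comp _ t, ← wR_comp _ (t ≫ _), ← wR_comp, Strict.assoc t, t₃, r₁, h₁]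
    refine ⟨θ, H.arrow_ext (s.isStrictPullback.arrow_ext s₁ s₂)
      (s.isStrictPullback.arrow_ext s₃ s₄), P.arrow_ext ?_ ?_⟩
    · rw [P.wR_pair_fst, h₀]
    · rw [P.wR_pair_snd, h₁]

theorem isCompleteCongruence (hC : IsPita C) : IsCompleteCongruence s.nerve where
  isGboCongruence := s.isGboCongruence (hC.nonempty_strictProd _ _).some
  isRezkComplete := s.isRezkComplete hC

end NerveSpec

/-! ### Internal functors between nerves as cocones -/

namespace NerveSpec

variable {C : Type u} [Bicategory.{w, v} C] [Bicategory.Strict C] {X Y : C}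
  (s : NerveSpec X) (t : NerveSpec Y)

/-- The cocone under the nerve of `X` with vertex `Y` corresponding to an internal functor between
nerves: its composite with the tautological cocone under the nerve of `Y`. -/
noncomputable def toCocone (F : s.nerve ⟶ t.nerve) : Cocone s.nerve Y := by
  have hl : (t.cell F.f₁).left = s.π₀ ≫ F.f₀ ≫ t.core₀.ι :=
    (t.cell_left F.f₁).trans
      ((congrArg (fun x => x ≫ t.core₀.ι) F.f₁_π₀).trans (Strict.assoc s.π₀ F.f₀ t.core₀.ι))
  have hr : (t.cell F.f₁).right = s.π₁ ≫ F.f₀ ≫ t.core₀.ι :=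
    (t.cell_right F.f₁).trans
      ((congrArg (fun x => x ≫ t.core₀.ι) F.f₁_π₁).trans (Strict.assoc s.π₁ F.f₀ t.core₀.ι))
  have hc : Arrow.mk (eqToHom hl.symm ≫ (t.cell F.f₁).hom ≫ eqToHom hr) = t.cell F.f₁ :=
    (Arrow.arrow_mk_eqToHom_comp _ _).trans (Arrow.arrow_mk_comp_eqToHom _ _)
  have hw : ∀ {A : C} (x : A ⟶ s.core₁.obj),
      wL x (Arrow.mk (eqToHom hl.symm ≫ (t.cell F.f₁).hom ≫ eqToHom hr)) =
        t.cell (x ≫ F.f₁) :=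
    fun x => (congrArg (wL x) hc).trans (t.cell_comp x F.f₁).symm
  exact
    { γ := F.f₀ ≫ t.core₀.ι
      γ₀₁ := eqToHom hl.symm ≫ (t.cell F.f₁).hom ≫ eqToHom hr
      unit := by
        refine (hw s.e).trans ?_
        exact (congrArg t.cell F.e_f₁).trans (t.cell_e F.f₀)
      mul := by
        refine (hw s.π₀₂).trans ((congrArg t.cell F.π₀₂_f₁).trans ((t.cell_mul _ _ _).trans ?_))
        exact acomp_congr _ (hw s.π₀₁).symm (hw s.π₁₂).symm }

theorem mk_toCocone_γ₀₁ (F : s.nerve ⟶ t.nerve) :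
    Arrow.mk (s.toCocone t F).γ₀₁ = t.cell F.f₁ :=
  (Arrow.arrow_mk_eqToHom_comp _ _).trans (Arrow.arrow_mk_comp_eqToHom _ _)

theorem mk_push (c : X ⟶ Y) : Arrow.mk (s.tautologicalCocone.push c) = wR (s.cell (𝟙 _)) c := by
  have h := s.wL_tautologicalCell (𝟙 _)
  rw [wL_id] at h
  rw [← h]
  unfold Cocone.push
  rw [Strict.associator_eqToIso, Strict.associator_eqToIso]
  simp only [eqToIso.inv, eqToIso.hom]
  rw [Arrow.arrow_mk_eqToHom_comp, Arrow.arrow_mk_comp_eqToHom]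
  rfl

theorem hom_eq_of_cell {F G : s.nerve ⟶ t.nerve} (h₀ : F.f₀ ≫ t.core₀.ι = G.f₀ ≫ t.core₀.ι)
    (h₁ : t.cell F.f₁ = t.cell G.f₁) : F = G :=
  InternalCat.hom_ext (t.core₀.hom_ext h₀) (t.cell_ext h₁)

theorem nerveMap_eq_iff (F : s.nerve ⟶ t.nerve) (f : X ⟶ Y) :
    s.nerveMap t f = F ↔ s.tautologicalCocone.γ ≫ f = (s.toCocone t F).γ ∧
      Arrow.mk (s.tautologicalCocone.push f) = Arrow.mk (s.toCocone t F).γ₀₁ := by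
  have h₀ : s.map₀ t f ≫ t.core₀.ι = s.core₀.ι ≫ f := s.core₀.map_ι t.core₀ f
  have h₁ : t.cell (s.map₁ t f) = wR (s.cell (𝟙 _)) f := by
    simpa using s.cell_map₁ t f (𝟙 _)
  rw [mk_push, mk_toCocone_γ₀₁]
  constructor
  · rintro rfl
    exact ⟨h₀.symm, h₁.symm⟩
  · rintro ⟨e₀, e₁⟩
    exact s.hom_eq_of_cell t (h₀.trans e₀) (h₁.trans e₁)

/-- The functor from the category of morphisms `X ⟶ Y` to that of internal functors between nerves
is an isomorphism if the tautological cocone under the nerve of `X` is a strict quotient: an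
internal functor `F` is the nerve of `f` if and only if `f` is the morphism induced by the cocone of `F`, and
an internal transformation amounts to a morphism between such cocones. -/
theorem isIsoOfCats_nerveHom (hs : s.tautologicalCocone.IsStrictQuotient) :
    IsIsoOfCats (s.nerveHom t) where
  bijective_obj := by
    refine Function.bijective_iff_existsUnique _ |>.2 fun F => ?_
    obtain ⟨f, hf, huf⟩ := hs.existsUnique_map (s.toCocone t F)
    exact ⟨f, (s.nerveMap_eq_iff t F f).2 hf, fun g hg => huf g ((s.nerveMap_eq_iff t F g).1 hg)⟩
  bijective_map f g := by
    have key : ∀ {f g : X ⟶ Y} (α : f ⟶ g), t.cell (s.map₂ t α) = wL s.core₀.ι (Arrow.mk α) := by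
      intro f g α
      simpa using s.cell_map₂ t α (𝟙 _)
    have h₁ : ∀ f : X ⟶ Y, t.cell (s.map₁ t f) = wR (s.cell (𝟙 _)) f := fun f => by
      simpa using s.cell_map₁ t f (𝟙 _)
    refine Function.bijective_iff_existsUnique _ |>.2 fun η => ?_
    have h₀ : ∀ f : X ⟶ Y, s.map₀ t f ≫ t.core₀.ι = s.core₀.ι ≫ f := s.core₀.map_ι t.core₀
    have ha₀ : η.app ≫ t.π₀ = s.map₀ t f := η.app_π₀
    have ha₁ : η.app ≫ t.π₁ = s.map₀ t g := η.app_π₁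
    obtain ⟨α, hα⟩ := exists_arrow_mk_eq (t.cell η.app) (x := s.core₀.ι ≫ f)
      (y := s.core₀.ι ≫ g) 
      ((t.cell_left η.app).trans ((congrArg (fun x => x ≫ t.core₀.ι) ha₀).trans (h₀ f)))
      ((t.cell_right η.app).trans ((congrArg (fun x => x ≫ t.core₀.ι) ha₁).trans (h₀ g)))
    have hw : ∀ x : s.core₁.obj ⟶ s.core₀.obj, t.cell (x ≫ η.app) = Arrow.mk (x ◁ α) :=
      fun x => (t.cell_comp x η.app).trans (congrArg (wL x) hα.symm)
    obtain ⟨θ, hθ, huθ⟩ := hs.existsUnique_cell f g α (by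
      refine Arrow.mk_injective _ _ ?_
      refine (acomp_mk _ _).symm.trans (Eq.trans ?_ (acomp_mk _ _))
      have n := congrArg t.cell η.naturality
      have n' := (t.cell_mul _ _ _).symm.trans (n.symm.trans (t.cell_mul _ _ _))
      refine Eq.trans (acomp_congr _ (hw s.π₀).symm ((s.mk_push g).trans (h₁ g).symm)) (n'.trans ?_)
      exact acomp_congr _ ((h₁ f).trans (s.mk_push f).symm) (hw s.π₁))
    refine ⟨θ, ?_, ?_⟩
    · apply InternalCat.nat_ext
      apply t.cell_ext
      refine (key θ).trans ?_
      rw [← hα, ← hθ]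
      rfl
    · rintro θ' rfl
      refine huθ θ' (Arrow.mk_injective _ _ ?_)
      exact (key θ').symm.trans hα.symm

end NerveSpec

variable {C : Type u} [Bicategory.{w, v} C] [Bicategory.Strict C]

theorem areEquivalent_of_comp_eq_id {D : Type*} [Bicategory D] {X Y : D} {f : X ⟶ Y} {g : Y ⟶ X}
    (h : f ≫ g = 𝟙 X) (h' : g ≫ f = 𝟙 Y) : AreEquivalent X Y :=
  ⟨f, g, ⟨eqToIso h⟩, ⟨eqToIso h'⟩⟩

/-- Any two nerves of an object are isomorphic, hence equivalent in `Cong(C)`. -/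
theorem areEquivalent_of_nerves {X : C} (s t : NerveSpec X) (hs : IsCompleteCongruence s.nerve)
    (ht : IsCompleteCongruence t.nerve) :
    AreEquivalent (D := Cong C) ⟨s.nerve, hs⟩ ⟨t.nerve, ht⟩ := by
  have key : ∀ s t : NerveSpec X, s.nerveMap t (𝟙 X) ≫ t.nerveMap s (𝟙 X) = 𝟙 s.nerve := by
    intro s t
    rw [← s.nerveMap_comp t s, Strict.id_comp, s.nerveMap_id]
  let S : Cong C := ⟨s.nerve, hs⟩
  let T : Cong C := ⟨t.nerve, ht⟩
  let F : S ⟶ T := InducedBicategory.mkHom (s.nerveMap t (𝟙 X))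
  let G : T ⟶ S := InducedBicategory.mkHom (t.nerveMap s (𝟙 X))
  have hFG : F ≫ G = 𝟙 S := by
    ext
    exact key s t
  have hGF : G ≫ F = 𝟙 T := by
    ext
    exact key t s
  exact areEquivalent_of_comp_eq_id hFG hGF

theorem IsIsoOfCats.Nv_mapFunctor {σ : ∀ X : C, NerveSpec X}
    {h : ∀ X : C, IsCompleteCongruence (σ X).nerve} {X Y : C}
    (H : IsIsoOfCats ((σ X).nerveHom (σ Y))) : IsIsoOfCats ((Nv σ h).mapFunctor X Y) where
  bijective_obj := by
    refine ⟨fun f g e => H.bijective_obj.1 (congrArg InducedBicategory.Hom.hom e), fun F => ?_⟩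
    obtain ⟨f, hf⟩ := H.bijective_obj.2 F.hom
    refine ⟨f, ?_⟩
    ext
    exact hf
  bijective_map f g := by
    refine ⟨fun α β e => (H.bijective_map f g).1 (congrArg InducedBicategory.Hom₂.hom e),
      fun η => ?_⟩
    obtain ⟨α, hα⟩ := (H.bijective_map f g).2 η.hom
    refine ⟨α, ?_⟩
    ext
    exact hα

end TwoCat

theorem mainTheorem2 {C : Type u} [Bicategory.{w, v} C] [Bicategory.Strict C]
    (hC : TwoCat.IsGroupoidant C) :
    (∀ X : C, Nonempty (TwoCat.NerveSpec X)) ∧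
    ∃ h : ∀ (X : C) (s : TwoCat.NerveSpec X), TwoCat.IsCompleteCongruence s.nerve,
      (∀ (X Y : C) (s : TwoCat.NerveSpec X) (t : TwoCat.NerveSpec Y),
        TwoCat.IsIsoOfCats (s.nerveHom t)) ∧
      ∀ σ : ∀ X : C, TwoCat.NerveSpec X,
        TwoCat.IsStrictEquivalence (TwoCat.Nv σ fun X => h X (σ X)) := by
  have hiso : ∀ (X Y : C) (s : TwoCat.NerveSpec X) (t : TwoCat.NerveSpec Y),
      TwoCat.IsIsoOfCats (s.nerveHom t) := fun X Y s t =>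
    s.isIsoOfCats_nerveHom t (hC.quotients X s)
  refine ⟨hC.nonempty_nerveSpec, fun X s => s.isCompleteCongruence hC.pita, hiso, fun σ => ?_⟩
  refine ⟨?_, fun X Y => (hiso X Y (σ X) (σ Y)).Nv_mapFunctor⟩
  rintro ⟨I, hI⟩
  obtain ⟨X, s, rfl⟩ := hC.nerves I hI
  exact ⟨X, TwoCat.areEquivalent_of_nerves (σ X) s _ hI⟩
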